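/- Consider a GI/GI/1/1 system: packets arrive at a single server without queue; an arrival finding the server busy is discarded, any other arrival is served at once (an arrival at the very instant of a departure is accepted). The inter-arrival times are i.i.d., the service times are i.i.d., both are non-negative with finite positive means, and the two sequences are independent of each other. The system is observed on $[0,\infty)$; its state at time $0$ (arrival times of the last two accepted packets before time $0$, the later of which may still be in service, its departure time, and the time of the first arrival after $0$) has an arbitrary law, independent of the later inter-arrival times and of the service times of the packets accepted later. Number by $k=0,1,2,\dots$ the packets accepted after time $0$; let $T_A(k)$, $X_k$, $T_D(k)=T_A(k)+X_k$ be the arrival time, service time and departure time of packet $k$. For $k\ge1$ let $I_k=T_A(k)-T_D(k-1)$ be the idle time just before the service of packet $k$, and let $\check Z_k$ be the time between the arrival of packet $k$ and the arrival (discarded or not) immediately before it. The age of information (AoI) $\Delta(t)$ is $t$ minus the latest arrival time of a packet that has departed by time $t$ (packets accepted before time $0$ included). Let $d>0$, let $k\ge1$, write $(x)^+=\max(0,x)$ and put $$\gamma^*(k)=\min\{(X_k+X_{k-1}+I_k-d)^+,\;X_k+I_k\},\qquad \Gamma_1(k)=\min\{(X_{k-1}+\check Z_k+X_k-d)^+,\;X_k+\check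 Z_k\}.$$ Then $X_k$, $I_k$, $\gamma^*(k)$ and $\Gamma_1(k)$ are integrable and $\mathbb E[X_k]+\mathbb E[I_k]>0$. Put $\nu=1/(\mathbb E[X_k]+\mathbb E[I_k])$. If the process $(\Delta(t))_{t\ge0}$ is stationary, then the violation probability $\mathbb P(\Delta>d)=\lim_{t\to\infty}\mathbb P(\Delta(t)>d)$ exists, and for every real $\hat\nu\ge\nu$ $$\mathbb P(\Delta>d)=\nu\,\mathbb E[\gamma^*(k)]\;\le\;\Phi_1=\hat\nu\,\mathbb E[\Gamma_1(k)].$$ -/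

import Mathlib

open MeasureTheory ProbabilityTheory Filter Topology

noncomputable section

/-- Random data driving a single-server system without queue, observed on `[0, ∞)`.
Arrivals after time `0` are numbered `0, 1, 2, …`; those which find the server busy are discarded.
The packets accepted from among them are numbered `k = 0, 1, 2, …`. -/
structure GG11 (Ω : Type*) where
  /-- `Z n` is the time between arrival `n` and arrival `n + 1`. -/
  Z : ℕ → Ω → ℝ
  /-- `X k` is the service time of the accepted packet `k`. -/
  X : ℕ → Ω → ℝ
  /-- Time (after `0`) of arrival `0`. -/
  F : Ω → ℝ
  /-- Arrival time of the last packet accepted before time `0` (call it the initial packet). -/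
  A : Ω → ℝ
  /-- Departure time of the initial packet; if it is positive, the server is busy at time `0`. -/
  D : Ω → ℝ
  /-- Arrival time of the packet delivered just before the initial packet. -/
  U : Ω → ℝ

namespace GG11

variable {Ω : Type*}

/-- Time of arrival `n`, counting discarded arrivals too. -/
def S (q : GG11 Ω) (n : ℕ) (ω : Ω) : ℝ := q.F ω + ∑ i ∈ Finset.range n, q.Z i ω

/-- `N k` is the number, among all arrivals, of the accepted packet `k`: the first arrival after
the preceding accepted packet which does not come before the departure of that packet. -/
def N (q : GG11 Ω) : ℕ → Ω → ℕ
  | 0, ω => sInf {n | q.D ω ≤ q.S n ω}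
  | k + 1, ω => sInf {n | N q k ω < n ∧ q.S (N q k ω) ω + q.X k ω ≤ q.S n ω}

/-- Arrival time of packet `k`. -/
def TA (q : GG11 Ω) (k : ℕ) (ω : Ω) : ℝ := q.S (q.N k ω) ω

/-- Departure time of packet `k`, which is served on arrival. -/
def TD (q : GG11 Ω) (k : ℕ) (ω : Ω) : ℝ := q.TA k ω + q.X k ω

/-- Age of information at time `t ≥ 0`: `t` minus the latest arrival time among the packets which
have departed by time `t`. -/
def aoi (q : GG11 Ω) (t : ℝ) (ω : Ω) : ℝ :=
  t - sSup ({q.U ω} ∪ {a | a = q.A ω ∧ q.D ω ≤ t} ∪ {a | ∃ k, a = q.TA k ω ∧ q.TD k ω ≤ t})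

/-- Idle time `I_k` just before the service of packet `k` (`1 ≤ k`). -/
def idle (q : GG11 Ω) (k : ℕ) (ω : Ω) : ℝ := q.TA k ω - q.TD (k - 1) ω

/-- Inter-arrival time `Ž_k` between packet `k` (`1 ≤ k`) and the arrival preceding it,
discarded or not. -/
def Zcheck (q : GG11 Ω) (k : ℕ) (ω : Ω) : ℝ := q.S (q.N k ω) ω - q.S (q.N k ω - 1) ω

/-- `γ*(k)` for age limit `d` (`1 ≤ k`). -/
def gammaStar (q : GG11 Ω) (d : ℝ) (k : ℕ) (ω : Ω) : ℝ :=
  min (max 0 (q.X k ω + q.X (k - 1) ω + q.idle k ω - d)) (q.X k ω + q.idle k ω)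

/-- `Γ₁(k)` for age limit `d` (`1 ≤ k`). -/
def Gamma1 (q : GG11 Ω) (d : ℝ) (k : ℕ) (ω : Ω) : ℝ :=
  min (max 0 (q.X (k - 1) ω + q.Zcheck k ω + q.X k ω - d)) (q.X k ω + q.Zcheck k ω)

/-- The GI/GI/1/1 assumptions: i.i.d. inter-arrival times, i.i.d. service times, with finite
positive means, the two sequences being independent of each other. The state of the system at
time `0` has an arbitrary law, independent of the two sequences. -/
structure IsGIGI11 [MeasurableSpace Ω] (P : Measure Ω) (q : GG11 Ω) : Prop where
  measurable_Z : ∀ n, Measurable (q.Z n)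
  measurable_X : ∀ k, Measurable (q.X k)
  measurable_F : Measurable q.F
  measurable_A : Measurable q.A
  measurable_D : Measurable q.D
  measurable_U : Measurable q.U
  Z_nonneg : ∀ n, ∀ᵐ ω ∂P, 0 ≤ q.Z n ω
  X_nonneg : ∀ k, ∀ᵐ ω ∂P, 0 ≤ q.X k ω
  Z_indep : iIndepFun q.Z P
  Z_ident : ∀ n, IdentDistrib (q.Z n) (q.Z 0) P P
  X_indep : iIndepFun q.X P
  X_ident : ∀ k, IdentDistrib (q.X k) (q.X 0) P P
  Z_integrable : Integrable (q.Z 0) P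
  Z_mean_pos : 0 < ∫ ω, q.Z 0 ω ∂P
  X_integrable : Integrable (q.X 0) P
  X_mean_pos : 0 < ∫ ω, q.X 0 ω ∂P
  ZX_indep : IndepFun (fun ω n => q.Z n ω) (fun ω k => q.X k ω) P
  init_indep : IndepFun (fun ω => (q.F ω, q.A ω, q.D ω, q.U ω))
    (fun ω => ((fun n => q.Z n ω), (fun k => q.X k ω))) P
  init_order : ∀ᵐ ω ∂P, q.U ω ≤ q.A ω ∧ q.A ω ≤ 0 ∧ q.A ω ≤ q.D ω ∧ 0 ≤ q.F ω

/-- Expected departure rate `ν = 1 / (E[X_k] + E[I_k])` (`1 ≤ k`). -/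
def nu [MeasurableSpace Ω] (P : Measure Ω) (q : GG11 Ω) (k : ℕ) : ℝ :=
  1 / (∫ ω, q.X k ω ∂P + ∫ ω, q.idle k ω ∂P)

end GG11

/-- (Strict) stationarity of a real process on `[0, ∞)`: its finite-dimensional distributions are
invariant under time shifts. -/
def IsStationaryProcess {Ω : Type*} [MeasurableSpace Ω] (P : Measure Ω) (Y : ℝ → Ω → ℝ) : Prop :=
  ∀ (n : ℕ) (t : Fin n → ℝ), (∀ i, 0 ≤ t i) → ∀ s : ℝ, 0 ≤ s →
    IdentDistrib (fun ω i => Y (t i + s) ω) (fun ω i => Y (t i) ω) P P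

end

/-! Each accepted packet starts a regeneration. From its arrival on, the remaining inter-arrival and
service times form i.i.d. sequences, independent of what happened before. The next accepted packet
sits at a stopping index: the first later partial sum of inter-arrival times that reaches the
service time. By the strong Markov property (`measurePreserving_stopped`), the pair (service time,
following idle time) is independent of the state seen by the next packet, and that state has the
same law (`measurePreserving_firstCycle_advance`). The arbitrary initial state only changes the
stopping index of packet 0, so it leaves this law untouched (`measurePreserving_state_zero`).

Between two successive departures the AoI is the time since the arrival of the former packet, so the
time spent above `d` there is exactly `γ*` (`integral_violation_cycle`). The gap between the
departures is `X + I`. Both depend on two consecutive cycles, and a strong law for such functions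
gives, almost surely, the long-run fraction of time above `d` as `ν E[γ*]` (`ae_tendsto_violation`).
Fubini and dominated convergence turn this into a time average of probabilities. Stationarity makes
the violation probability constant in time, so it equals that average (`measureReal_aoi_eq`).

For the bound, the arrival before packet `k` comes no later than the departure of packet `k - 1`,
hence `I_k ≤ Ž_k` and `γ* ≤ Γ₁` almost surely. Integrability of `I_k` reduces in the same way to
that of `Ž_k`, which follows from an argument of Wald type (`tsum_notHit_lt_top`,
`integrable_last`). -/

namespace GG11

/-! ### I.i.d. sequences and the strong Markov property. -/

/-- The law of an i.i.d. sequence with marginal `ν`. -/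
noncomputable abbrev iidLaw (ν : Measure ℝ) : Measure (ℕ → ℝ) := Measure.infinitePi fun _ => ν

/-- Drop the first `j` terms. -/
def shift (j : ℕ) (z : ℕ → ℝ) : ℕ → ℝ := fun i => z (j + i)

/-- Replace all terms but the first `j` by `0`. -/
def trunc (j : ℕ) (z : ℕ → ℝ) : ℕ → ℝ := fun i => if i < j then z i else 0

theorem measurable_shift (j : ℕ) : Measurable (shift j) :=
  measurable_pi_lambda _ fun i => measurable_pi_apply (j + i)

theorem measurable_trunc (j : ℕ) : Measurable (trunc j) := by
  refine measurable_pi_lambda _ fun i => ?_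
  unfold trunc
  split_ifs <;> fun_prop

theorem measurePreserving_shift (ν : Measure ℝ) [IsProbabilityMeasure ν] (j : ℕ) :
    MeasurePreserving (shift j) (iidLaw ν) (iidLaw ν) :=
  ⟨measurable_shift j, Measure.map_infinitePi_infinitePi_of_inj (P := fun _ : ℕ => ν)
    (f := fun i => j + i) (fun a b h => by simpa using h)⟩

/-- The two maps are measurable with respect to the coordinates below `j` and from `j` on, which are
disjoint families of independent variables. -/
theorem indepFun_trunc_shift (ν : Measure ℝ) [IsProbabilityMeasure ν] (j : ℕ) :
    IndepFun (trunc j) (shift j) (iidLaw ν) := by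
  have hi : iIndepFun (fun (i : ℕ) (z : ℕ → ℝ) => z i) (iidLaw ν) :=
    iIndepFun_infinitePi (P := fun _ : ℕ => ν) (X := fun _ x => x) fun _ => measurable_id
  have h := indep_iSup_of_disjoint (fun i => (measurable_pi_apply i).comap_le) hi
    (S := {i | i < j}) (T := {i | j ≤ i})
    (Set.disjoint_left.2 fun i (h1 : i < j) (h2 : j ≤ i) => by omega)
  rw [IndepFun_iff_Indep]
  refine indep_of_indep_of_le_left (indep_of_indep_of_le_right h ?_) ?_
  · rw [← measurable_iff_comap_le]
    refine @measurable_pi_lambda _ _ _ (_) _ _ fun i => ?_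
    refine Measurable.mono (ma := MeasurableSpace.comap (fun z : ℕ → ℝ => z (j + i)) inferInstance)
      ?_ ?_ le_rfl
    · exact comap_measurable _
    · exact le_iSup₂_of_le (f := fun i (_ : i ∈ {i | j ≤ i}) =>
        MeasurableSpace.comap (fun z : ℕ → ℝ => z i) inferInstance) (j + i)
        (Nat.le_add_right _ _) le_rfl
  · rw [← measurable_iff_comap_le]
    refine @measurable_pi_lambda _ _ _ (_) _ _ fun i => ?_
    unfold trunc
    split_ifs with hij
    · refine Measurable.mono (ma := MeasurableSpace.comap (fun z : ℕ → ℝ => z i) inferInstance)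
        ?_ ?_ le_rfl
      · exact comap_measurable _
      · exact le_iSup₂_of_le (f := fun i (_ : i ∈ {i | i < j}) =>
          MeasurableSpace.comap (fun z : ℕ → ℝ => z i) inferInstance) i hij le_rfl
    · exact measurable_const

/-- A random variable, the first `j` terms and the remaining terms of an i.i.d. sequence. -/
theorem measurePreserving_trunc_shift (τ : Measure ℝ) [IsProbabilityMeasure τ]
    (ν : Measure ℝ) [IsProbabilityMeasure ν] (j : ℕ) :
    MeasurePreserving (fun p : ℝ × (ℕ → ℝ) => ((p.1, trunc j p.2), shift j p.2))
      (τ.prod (iidLaw ν)) ((τ.prod ((iidLaw ν).map (trunc j))).prod (iidLaw ν)) := by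
  have := Measure.isProbabilityMeasure_map (μ := iidLaw ν) (measurable_trunc j).aemeasurable
  have h : MeasurePreserving (fun z : ℕ → ℝ => (trunc j z, shift j z)) (iidLaw ν)
      (((iidLaw ν).map (trunc j)).prod (iidLaw ν)) := by
    refine ⟨(measurable_trunc j).prodMk (measurable_shift j), ?_⟩
    rw [(indepFun_trunc_shift ν j).map_prod_eq_prod_map_map (measurable_trunc j).aemeasurable
      (measurable_shift j).aemeasurable, (measurePreserving_shift ν j).map_eq]
  have h2 := ((MeasurePreserving.id τ).prod h)
  exact (MeasurePreserving.symm MeasurableEquiv.prodAssoc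
    (measurePreserving_prodAssoc τ ((iidLaw ν).map (trunc j)) (iidLaw ν))).comp h2

theorem measurePreserving_trunc (τ : Measure ℝ) [IsProbabilityMeasure τ]
    (ν : Measure ℝ) [IsProbabilityMeasure ν] (j : ℕ) :
    MeasurePreserving (fun p : ℝ × (ℕ → ℝ) => (p.1, trunc j p.2))
      (τ.prod (iidLaw ν)) (τ.prod ((iidLaw ν).map (trunc j))) :=
  measurePreserving_fst.comp (measurePreserving_trunc_shift τ ν j)

/-- A set determined by the first `j` terms is independent of the remaining terms. -/
theorem measure_inter_shift (τ : Measure ℝ) [IsProbabilityMeasure τ]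
    (ν : Measure ℝ) [IsProbabilityMeasure ν] (j : ℕ) {E : Set (ℝ × (ℕ → ℝ))}
    (hE : MeasurableSet E) (hdet : ∀ p : ℝ × (ℕ → ℝ), (p.1, trunc j p.2) ∈ E ↔ p ∈ E)
    {C : Set (ℕ → ℝ)} (hC : MeasurableSet C) :
    τ.prod (iidLaw ν) (E ∩ {p | shift j p.2 ∈ C}) = τ.prod (iidLaw ν) E * iidLaw ν C := by
  have := Measure.isProbabilityMeasure_map (μ := iidLaw ν) (measurable_trunc j).aemeasurable
  have h1 := (measurePreserving_trunc_shift τ ν j).measure_preimage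
    (hE.prod hC).nullMeasurableSet
  have h2 := (measurePreserving_trunc τ ν j).measure_preimage hE.nullMeasurableSet
  rw [Measure.prod_prod, ← h2] at h1
  -- `hdet` expresses that `E` depends on the first `j` terms only: `E` is its own preimage under
  -- truncation.
  have e2 : (fun p : ℝ × (ℕ → ℝ) => (p.1, trunc j p.2)) ⁻¹' E = E := by
    ext p; exact hdet p
  have e1 : (fun p : ℝ × (ℕ → ℝ) => ((p.1, trunc j p.2), shift j p.2)) ⁻¹' (E ×ˢ C)
      = E ∩ {p | shift j p.2 ∈ C} := by
    ext p; simp [hdet p]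
  rw [e1, e2] at h1
  exact h1

/-- The integral over a set determined by the first `j` terms of a function of term `j`. -/
theorem setLIntegral_apply (τ : Measure ℝ) [IsProbabilityMeasure τ]
    (ν : Measure ℝ) [IsProbabilityMeasure ν] (j : ℕ) {E : Set (ℝ × (ℕ → ℝ))}
    (hE : MeasurableSet E) (hdet : ∀ p : ℝ × (ℕ → ℝ), (p.1, trunc j p.2) ∈ E ↔ p ∈ E)
    {g : ℝ → ENNReal} (hg : Measurable g) :
    ∫⁻ p, E.indicator (fun p => g (p.2 j)) p ∂(τ.prod (iidLaw ν))
      = τ.prod (iidLaw ν) E * ∫⁻ a, g a ∂ν := by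
  have := Measure.isProbabilityMeasure_map (μ := iidLaw ν) (measurable_trunc j).aemeasurable
  have hg0 : Measurable fun z : ℕ → ℝ => g (z 0) := hg.comp (measurable_pi_apply 0)
  have h1 := (measurePreserving_trunc_shift τ ν j).lintegral_comp
    (f := fun p => E.indicator 1 p.1 * g (p.2 0))
    (((measurable_one.indicator hE).comp measurable_fst).mul (hg0.comp measurable_snd))
  rw [lintegral_prod_mul (measurable_one.indicator hE).aemeasurable hg0.aemeasurable,
    lintegral_indicator_one hE, ← (measurePreserving_trunc τ ν j).measure_preimage
      hE.nullMeasurableSet, ← (measurePreserving_eval_infinitePi (fun _ : ℕ => ν) 0).lintegral_comp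
        hg] at *
  have e2 : (fun p : ℝ × (ℕ → ℝ) => (p.1, trunc j p.2)) ⁻¹' E = E := by
    ext p; exact hdet p
  rw [e2] at h1
  refine Eq.trans (lintegral_congr fun p => ?_) h1
  by_cases hp : p ∈ E
  · simp [hp, (hdet p).2 hp, shift]
  · have : (p.1, trunc j p.2) ∉ E := fun h => hp ((hdet p).1 h)
    simp [hp, this]

theorem measurable_comp_index {α β : Type*} [MeasurableSpace α] [MeasurableSpace β]
    {f : ℕ → α → β} (hf : ∀ n, Measurable (f n)) {m : α → ℕ} (hm : Measurable m) :
    Measurable fun a => f (m a) a := by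
  have : Measurable fun p : ℕ × α => f p.1 p.2 := measurable_from_prod_countable_right hf
  exact this.comp (hm.prodMk measurable_id)

/-- The strong Markov property of an i.i.d. sequence: what is known at the random index `m` is
independent of the later terms, which again form an i.i.d. sequence. -/
theorem measurePreserving_stopped {S : Type*} [MeasurableSpace S]
    (τ : Measure ℝ) [IsProbabilityMeasure τ] (ν : Measure ℝ) [IsProbabilityMeasure ν]
    {m : ℝ × (ℕ → ℝ) → ℕ} (hm : Measurable m) {B : ℕ → Set (ℝ × (ℕ → ℝ))}
    (hB : ∀ j, MeasurableSet (B j))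
    (hdet : ∀ (j : ℕ) (p : ℝ × (ℕ → ℝ)), (p.1, trunc j p.2) ∈ B j ↔ p ∈ B j)
    (hBm : ∀ (j : ℕ), ∀ p ∈ B j, m p = j) (hcov : ∀ᵐ p ∂τ.prod (iidLaw ν), ∃ j, p ∈ B j)
    {f : ℝ × (ℕ → ℝ) → S} (hf : Measurable f)
    (hfdet : ∀ (j : ℕ), ∀ p ∈ B j, f (p.1, trunc j p.2) = f p) :
    MeasurePreserving (fun p => (f p, shift (m p) p.2)) (τ.prod (iidLaw ν))
      (((τ.prod (iidLaw ν)).map f).prod (iidLaw ν)) := by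
  have hs : Measurable fun p : ℝ × (ℕ → ℝ) => shift (m p) p.2 :=
    measurable_comp_index (f := fun n (p : ℝ × (ℕ → ℝ)) => shift n p.2)
      (fun n => (measurable_shift n).comp measurable_snd) hm
  have hd : Pairwise (Function.onFun Disjoint B) := fun i j hij =>
    Set.disjoint_left.2 fun p h1 h2 => hij ((hBm i p h1).symm.trans (hBm j p h2))
  -- The events `B j` partition the space up to a null set, so it suffices to work where the random
  -- index is a fixed `j`.
  have key : ∀ E : Set (ℝ × (ℕ → ℝ)), MeasurableSet E →
      τ.prod (iidLaw ν) E = ∑' j, τ.prod (iidLaw ν) (B j ∩ E) := by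
    intro E hE
    rw [← measure_iUnion (fun i j hij => (hd hij).mono Set.inter_subset_left Set.inter_subset_left)
      fun j => (hB j).inter hE]
    refine measure_congr ?_
    filter_upwards [hcov] with p hp
    refine propext ⟨fun h => Set.mem_iUnion.2 ?_, fun h => ?_⟩
    · obtain ⟨j, hj⟩ := hp
      exact ⟨j, hj, h⟩
    · obtain ⟨j, hj⟩ := Set.mem_iUnion.1 h
      exact hj.2
  have := Measure.isProbabilityMeasure_map (μ := τ.prod (iidLaw ν)) hf.aemeasurable
  refine ⟨hf.prodMk hs, (Measure.prod_eq fun A C hA hC => ?_).symm⟩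
  rw [Measure.map_apply (hf.prodMk hs) (hA.prod hC), Measure.map_apply hf hA,
    key _ ((hf.prodMk hs) (hA.prod hC)), key _ (hf hA), ← ENNReal.tsum_mul_right]
  refine tsum_congr fun j => ?_
  rw [← measure_inter_shift τ ν j ((hB j).inter (hf hA)) ?_ hC]
  · congr 1
    ext p
    constructor
    · rintro ⟨h1, h2, h3⟩
      refine ⟨⟨h1, h2⟩, ?_⟩
      simpa [hBm j p h1] using h3
    · rintro ⟨⟨h1, h2⟩, h3⟩
      refine ⟨h1, h2, ?_⟩
      simpa [hBm j p h1] using h3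
  · intro p
    simp only [Set.mem_inter_iff, hdet j p, Set.mem_preimage]
    refine and_congr_right fun h => ?_
    rw [hfdet j p h]

end GG11

/-! ### First passage of partial sums. -/

namespace GG11

/-- Sum of the first `n` terms. -/
noncomputable def psum (z : ℕ → ℝ) (n : ℕ) : ℝ := ∑ i ∈ Finset.range n, z i

theorem psum_add (z : ℕ → ℝ) (j n : ℕ) : psum z (j + n) = psum z j + psum (shift j z) n := by
  simp [psum, shift, Finset.sum_range_add]

theorem psum_trunc (z : ℕ → ℝ) {i j : ℕ} (h : i ≤ j) : psum (trunc j z) i = psum z i := by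
  refine Finset.sum_congr rfl fun l hl => ?_
  have : l < j := (Finset.mem_range.1 hl).trans_le h
  simp [trunc, this]

theorem measurable_psum (n : ℕ) : Measurable fun z => psum z n := by
  unfold psum; fun_prop

/-- The first index, from `l` on, at which the partial sum of `p.2` reaches `p.1`. -/
noncomputable def firstIdx (l : ℕ) (p : ℝ × (ℕ → ℝ)) : ℕ := sInf {n | l ≤ n ∧ p.1 ≤ psum p.2 n}

/-- The event that the level `p.1` is reached at index `j` for the first time. -/
def hitSet (l j : ℕ) : Set (ℝ × (ℕ → ℝ)) :=
  {p | l ≤ j ∧ p.1 ≤ psum p.2 j ∧ ∀ i < j, l ≤ i → psum p.2 i < p.1}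

/-- A sequence of non-negative numbers with unbounded partial sums. -/
def Good (z : ℕ → ℝ) : Prop := (∀ i, 0 ≤ z i) ∧ ∀ x : ℝ, ∃ n, x ≤ psum z n

theorem psum_mono {z : ℕ → ℝ} (hz : ∀ i, 0 ≤ z i) : Monotone (psum z) := fun _ _ h =>
  Finset.sum_le_sum_of_subset_of_nonneg (Finset.range_mono h) fun i _ _ => hz i

theorem Good.exists_le {z : ℕ → ℝ} (hz : Good z) (l : ℕ) (x : ℝ) : ∃ n, l ≤ n ∧ x ≤ psum z n := by
  obtain ⟨n, hn⟩ := hz.2 x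
  exact ⟨max l n, le_max_left _ _, hn.trans (psum_mono hz.1 (le_max_right _ _))⟩

theorem Good.shift {z : ℕ → ℝ} (hz : Good z) (j : ℕ) : Good (shift j z) := by
  refine ⟨fun i => hz.1 _, fun x => ?_⟩
  obtain ⟨n, hjn, hn⟩ := hz.exists_le j (psum z j + x)
  obtain ⟨m, rfl⟩ := Nat.exists_eq_add_of_le hjn
  rw [psum_add] at hn
  exact ⟨m, by linarith⟩

theorem measurable_sInf_nat {α : Type*} [MeasurableSpace α] {s : ℕ → α → Prop}
    (hs : ∀ n, MeasurableSet {a | s n a}) : Measurable fun a => sInf {n | s n a} := by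
  refine measurable_to_countable' fun j => ?_
  have : (fun a => sInf {n | s n a}) ⁻¹' {j} =
      -- The second piece accounts for the default value `sInf ∅ = 0`.
      ({a | s j a} ∩ ⋂ i, ⋂ (_ : i < j), {a | s i a}ᶜ) ∪ ({_a | j = 0} ∩ ⋂ i, {a | s i a}ᶜ) := by
    ext a
    simp only [Set.mem_preimage, Set.mem_singleton_iff, Set.mem_union, Set.mem_inter_iff,
      Set.mem_ofPred_eq, Set.mem_iInter, Set.mem_compl_iff]
    constructor
    · rintro rfl
      by_cases h : {n | s n a}.Nonempty
      · exact Or.inl ⟨Nat.sInf_mem h, fun i hi => Nat.notMem_of_lt_sInf hi⟩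
      · rw [Set.not_nonempty_iff_eq_empty] at h
        refine Or.inr ⟨by rw [h]; simp, fun i hi => ?_⟩
        have : i ∈ {n | s n a} := hi
        simp [h] at this
    · rintro (⟨h1, h2⟩ | ⟨rfl, h⟩)
      · refine le_antisymm (Nat.sInf_le h1) (not_lt.1 fun hlt => h2 _ hlt
          (Nat.sInf_mem (s := {n | s n a}) ⟨j, h1⟩))
      · rw [show {n | s n a} = ∅ from Set.eq_empty_of_forall_notMem h]; simp
  rw [this]
  refine ((hs j).inter (MeasurableSet.iInter fun i => MeasurableSet.iInter fun _ =>
    (hs i).compl)).union (MeasurableSet.inter (MeasurableSet.const _)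
      (MeasurableSet.iInter fun i => (hs i).compl))

theorem measurable_firstIdx (l : ℕ) : Measurable (firstIdx l) := by
  refine measurable_sInf_nat fun n => ?_
  exact (MeasurableSet.const _).inter
    (measurableSet_le measurable_fst ((measurable_psum n).comp measurable_snd))

theorem measurableSet_hitSet (l j : ℕ) : MeasurableSet (hitSet l j) := by
  have h : ∀ n, Measurable fun p : ℝ × (ℕ → ℝ) => psum p.2 n :=
    fun n => (measurable_psum n).comp measurable_snd
  have h2 : MeasurableSet {p : ℝ × (ℕ → ℝ) | ∀ i < j, l ≤ i → psum p.2 i < p.1} := by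
    simp only [Set.ofPred_forall]
    exact MeasurableSet.iInter fun i => MeasurableSet.iInter fun _ => MeasurableSet.iInter fun _ =>
      measurableSet_lt (h i) measurable_fst
  exact (MeasurableSet.const _).inter ((measurableSet_le measurable_fst (h j)).inter h2)

/-- The stopping-time property: only partial sums up to index `j` enter, and these use the first `j`
terms. -/
theorem trunc_mem_hitSet (l j : ℕ) (p : ℝ × (ℕ → ℝ)) :
    (p.1, trunc j p.2) ∈ hitSet l j ↔ p ∈ hitSet l j := by
  simp only [hitSet, Set.mem_ofPred_eq, psum_trunc p.2 le_rfl]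
  refine and_congr_right fun _ => and_congr_right fun _ => forall₂_congr fun i hi => ?_
  rw [psum_trunc p.2 hi.le]

theorem firstIdx_eq_of_mem {l j : ℕ} {p : ℝ × (ℕ → ℝ)} (h : p ∈ hitSet l j) :
    firstIdx l p = j := by
  refine le_antisymm (Nat.sInf_le ⟨h.1, h.2.1⟩) (not_lt.1 fun hlt => ?_)
  have := Nat.sInf_mem (s := {n | l ≤ n ∧ p.1 ≤ psum p.2 n}) ⟨j, h.1, h.2.1⟩
  exact absurd this.2 (not_le.2 (h.2.2 _ hlt this.1))

theorem mem_hitSet_firstIdx (l : ℕ) {p : ℝ × (ℕ → ℝ)} (h : Good p.2) :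
    p ∈ hitSet l (firstIdx l p) := by
  have := Nat.sInf_mem (s := {n | l ≤ n ∧ p.1 ≤ psum p.2 n}) (h.exists_le l p.1)
  refine ⟨this.1, this.2, fun i hi hli => not_le.1 fun hle => ?_⟩
  exact Nat.notMem_of_lt_sInf hi ⟨hli, hle⟩

/-- The service time `p.1` and the idle time after it, when `p.2` are the inter-arrival times. -/
noncomputable def cycle (p : ℝ × (ℕ → ℝ)) : ℝ × ℝ := (p.1, psum p.2 (firstIdx 1 p) - p.1)

theorem measurable_cycle : Measurable cycle := by
  refine measurable_fst.prodMk (Measurable.sub ?_ measurable_fst)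
  exact measurable_comp_index (f := fun n (p : ℝ × (ℕ → ℝ)) => psum p.2 n)
    (fun n => (measurable_psum n).comp measurable_snd) (measurable_firstIdx 1)

section law

variable (τ : Measure ℝ) [IsProbabilityMeasure τ] (ν : Measure ℝ) [IsProbabilityMeasure ν]

/-- By the strong law the partial sums grow linearly, at the positive rate given by the mean. -/
theorem ae_good (h0 : ∀ᵐ a ∂ν, 0 ≤ a) (hi : Integrable (fun a => a) ν) (hpos : 0 < ∫ a, a ∂ν) :
    ∀ᵐ z ∂iidLaw ν, Good z := by
  have hev : ∀ i, MeasurePreserving (fun z : ℕ → ℝ => z i) (iidLaw ν) ν := fun i =>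
    measurePreserving_eval_infinitePi (fun _ : ℕ => ν) i
  have hid : iIndepFun (fun (i : ℕ) (z : ℕ → ℝ) => z i) (iidLaw ν) :=
    iIndepFun_infinitePi (P := fun _ : ℕ => ν) (X := fun _ x => x) fun _ => measurable_id
  have hlln := strong_law_ae_real (fun (i : ℕ) (z : ℕ → ℝ) => z i) (μ := iidLaw ν)
    ((hev 0).integrable_comp_of_integrable hi) (fun i j hij => hid.indepFun hij)
    (fun i => ⟨(hev i).measurable.aemeasurable, (hev 0).measurable.aemeasurable,
      (hev i).map_eq.trans (hev 0).map_eq.symm⟩)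
  have hint : ∫ z, z 0 ∂iidLaw ν = ∫ a, a ∂ν := by
    rw [← (hev 0).map_eq, integral_map (hev 0).measurable.aemeasurable (by fun_prop)]
    rw [(hev 0).map_eq]
  have hnn : ∀ᵐ z ∂iidLaw ν, ∀ i, 0 ≤ z i := ae_all_iff.2 fun i =>
    (hev i).quasiMeasurePreserving.ae h0
  filter_upwards [hlln, hnn] with z hz hz0
  refine ⟨hz0, fun x => ?_⟩
  rw [hint] at hz
  have : Tendsto (fun n : ℕ => psum z n) atTop atTop := by
    have h := hz.pos_mul_atTop hpos (tendsto_natCast_atTop_atTop (R := ℝ))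
    refine h.congr' ?_
    filter_upwards [eventually_gt_atTop 0] with n hn
    have : (n : ℝ) ≠ 0 := by positivity
    rw [psum]
    field_simp
  exact (this.eventually_ge_atTop x).exists

/-- The strong Markov property with no information retained. It serves for `l = 0`, where the level
is the residual busy time `D - F` at the first arrival. -/
theorem measurePreserving_shift_firstIdx (hg : ∀ᵐ z ∂iidLaw ν, Good z) (l : ℕ) :
    MeasurePreserving (fun p : ℝ × (ℕ → ℝ) => shift (firstIdx l p) p.2) (τ.prod (iidLaw ν))
      (iidLaw ν) := by
  have := Measure.isProbabilityMeasure_map (μ := τ.prod (iidLaw ν))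
    (f := fun _ => ()) measurable_const.aemeasurable
  refine measurePreserving_snd.comp (measurePreserving_stopped τ ν (f := fun _ => ())
    (measurable_firstIdx l) (measurableSet_hitSet l) (trunc_mem_hitSet l)
    (fun j p => firstIdx_eq_of_mem) ?_ measurable_const fun _ _ _ => rfl)
  filter_upwards [Measure.quasiMeasurePreserving_snd.ae hg] with p hp
  exact ⟨_, mem_hitSet_firstIdx l hp⟩

/-- On `hitSet 1 j` the cycle is computed from the level and the first `j` terms, so the strong
Markov property applies to it. -/
theorem measurePreserving_cycle_shift (hg : ∀ᵐ z ∂iidLaw ν, Good z) :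
    MeasurePreserving (fun p : ℝ × (ℕ → ℝ) => (cycle p, shift (firstIdx 1 p) p.2))
      (τ.prod (iidLaw ν)) (((τ.prod (iidLaw ν)).map cycle).prod (iidLaw ν)) := by
  refine measurePreserving_stopped τ ν
    (measurable_firstIdx 1) (measurableSet_hitSet 1) (trunc_mem_hitSet 1)
    (fun j p => firstIdx_eq_of_mem) ?_ measurable_cycle fun j p hp => ?_
  · filter_upwards [Measure.quasiMeasurePreserving_snd.ae hg] with p hp
    exact ⟨_, mem_hitSet_firstIdx 1 hp⟩
  · rw [cycle, cycle, firstIdx_eq_of_mem hp, firstIdx_eq_of_mem ((trunc_mem_hitSet 1 j p).2 hp),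
      psum_trunc _ le_rfl]

/-- The event that none of the indices `1, …, j` reaches the level. -/
def notHit (j : ℕ) : Set (ℝ × (ℕ → ℝ)) := {p | ∀ i ≤ j, 1 ≤ i → psum p.2 i < p.1}

theorem measurableSet_notHit (j : ℕ) : MeasurableSet (notHit j) := by
  simp only [notHit, Set.ofPred_forall]
  exact MeasurableSet.iInter fun i => MeasurableSet.iInter fun _ => MeasurableSet.iInter fun _ =>
    measurableSet_lt ((measurable_psum i).comp measurable_snd) measurable_fst

theorem trunc_mem_notHit (j : ℕ) (p : ℝ × (ℕ → ℝ)) :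
    (p.1, trunc j p.2) ∈ notHit j ↔ p ∈ notHit j := by
  simp only [notHit, Set.mem_ofPred_eq]
  refine forall₂_congr fun i hi => ?_
  rw [psum_trunc p.2 hi]

/-- While the level is not reached the partial sum stays below it, and the one further step adds at
most 1 because it is capped. -/
theorem sum_min_notHit_le {p : ℝ × (ℕ → ℝ)} (h0 : 0 ≤ p.1) (hz : ∀ i, 0 ≤ p.2 i) (n : ℕ) :
    ∑ j ∈ Finset.range n, (notHit j).indicator (fun p => ENNReal.ofReal (min (p.2 j) 1)) p
      ≤ ENNReal.ofReal (p.1 + 1) := by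
  induction n with
  | zero => simp
  | succ n ih =>
    by_cases hn : p ∈ notHit n
    · have hle : psum p.2 n ≤ p.1 := by
        rcases Nat.eq_zero_or_pos n with rfl | h
        · simpa [psum] using h0
        · exact (hn n le_rfl h).le
      calc _ ≤ ∑ j ∈ Finset.range (n + 1), ENNReal.ofReal (min (p.2 j) 1) :=
            Finset.sum_le_sum fun j _ => Set.indicator_le_self _ (fun p : ℝ × (ℕ → ℝ) =>
              ENNReal.ofReal (min (p.2 j) 1)) p
        _ = ENNReal.ofReal (∑ j ∈ Finset.range (n + 1), min (p.2 j) 1) :=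
            (ENNReal.ofReal_sum_of_nonneg fun j _ => le_min (hz j) zero_le_one).symm
        _ ≤ _ := by
          refine ENNReal.ofReal_le_ofReal ?_
          rw [Finset.sum_range_succ]
          refine add_le_add (le_trans ?_ hle) (min_le_right _ _)
          exact Finset.sum_le_sum fun j _ => min_le_left _ _
    · rw [Finset.sum_range_succ, Set.indicator_of_notMem hn, add_zero]
      exact ih

/-- The expected number of terms needed to reach an integrable level is finite. -/
theorem tsum_notHit_lt_top (hτ0 : ∀ᵐ a ∂τ, 0 ≤ a) (hτ : Integrable (fun a => a) τ)
    (h0 : ∀ᵐ a ∂ν, 0 ≤ a) (hpos : 0 < ∫ a, a ∂ν)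
    (hg : ∀ᵐ z ∂iidLaw ν, Good z) :
    ∑' j, τ.prod (iidLaw ν) (notHit j) < ⊤ := by
  have hmeas : Measurable fun a : ℝ => ENNReal.ofReal (min a 1) := by fun_prop
  -- Wald's identity for the steps `min Z 1`: the event `notHit j` is independent of term `j`. The
  -- cap bounds the overshoot by 1; the overshoot of the original steps is not yet known to be
  -- integrable.
  have hle : (∑' j, τ.prod (iidLaw ν) (notHit j)) * ∫⁻ a, ENNReal.ofReal (min a 1) ∂ν
      ≤ ∫⁻ a, ENNReal.ofReal (a + 1) ∂τ := by
    rw [← ENNReal.tsum_mul_right]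
    calc _ = ∑' j, ∫⁻ p, (notHit j).indicator (fun p => ENNReal.ofReal (min (p.2 j) 1)) p
            ∂(τ.prod (iidLaw ν)) := tsum_congr fun j =>
          (setLIntegral_apply τ ν j (measurableSet_notHit j) (trunc_mem_notHit j) hmeas).symm
      _ = ∫⁻ p, ∑' j, (notHit j).indicator (fun p => ENNReal.ofReal (min (p.2 j) 1)) p
            ∂(τ.prod (iidLaw ν)) := (lintegral_tsum fun j => ((hmeas.comp
          ((measurable_pi_apply j).comp measurable_snd)).indicator
            (measurableSet_notHit j)).aemeasurable).symm
      _ ≤ ∫⁻ p, ENNReal.ofReal (p.1 + 1) ∂(τ.prod (iidLaw ν)) := by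
          refine lintegral_mono_ae ?_
          filter_upwards [Measure.quasiMeasurePreserving_snd.ae hg,
            Measure.quasiMeasurePreserving_fst.ae hτ0] with p h1 h2
          exact ENNReal.tsum_le_of_sum_range_le (sum_min_notHit_le h2 h1.1)
      _ = _ := (measurePreserving_fst (μ := τ) (ν := iidLaw ν)).lintegral_comp
          (f := fun a => ENNReal.ofReal (a + 1)) (by fun_prop)
  have hfin : ∫⁻ a, ENNReal.ofReal (a + 1) ∂τ < ⊤ :=
    (hτ.add (integrable_const 1)).lintegral_lt_top
  have hne : ∫⁻ a, ENNReal.ofReal (min a 1) ∂ν ≠ 0 := by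
    intro h
    rw [lintegral_eq_zero_iff hmeas] at h
    have : ∀ᵐ a ∂ν, a = 0 := by
      filter_upwards [h, h0] with a h1 h2
      have : min a 1 ≤ 0 := ENNReal.ofReal_eq_zero.1 h1
      rcases min_le_iff.1 this with h | h
      · exact le_antisymm h h2
      · norm_num at h
    rw [integral_congr_ae this] at hpos
    simp at hpos
  exact (ENNReal.lt_top_of_mul_ne_top_left (hle.trans_lt hfin).ne hne)

/-- The inter-arrival time that ends at the index at which the level is reached is integrable. -/
theorem integrable_last (hτ0 : ∀ᵐ a ∂τ, 0 ≤ a) (hτ : Integrable (fun a => a) τ)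
    (h0 : ∀ᵐ a ∂ν, 0 ≤ a) (hi : Integrable (fun a => a) ν) (hpos : 0 < ∫ a, a ∂ν)
    (hg : ∀ᵐ z ∂iidLaw ν, Good z) :
    Integrable (fun p : ℝ × (ℕ → ℝ) => p.2 (firstIdx 1 p - 1)) (τ.prod (iidLaw ν)) := by
  have hm : Measurable fun p : ℝ × (ℕ → ℝ) => p.2 (firstIdx 1 p - 1) :=
    measurable_comp_index (f := fun n (p : ℝ × (ℕ → ℝ)) => p.2 (n - 1))
    (fun n => (measurable_pi_apply _).comp measurable_snd) (measurable_firstIdx 1)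
  refine ⟨hm.aestronglyMeasurable, ?_⟩
  rw [hasFiniteIntegral_iff_ofReal]
  swap
  · filter_upwards [Measure.quasiMeasurePreserving_snd.ae hg] with p hp using hp.1 _
  calc _ ≤ ∫⁻ p, ∑' j, (notHit j).indicator (fun p => ENNReal.ofReal (p.2 j)) p
            ∂(τ.prod (iidLaw ν)) := by
          refine lintegral_mono_ae ?_
          filter_upwards [Measure.quasiMeasurePreserving_snd.ae hg] with p hp
          have hmem := mem_hitSet_firstIdx 1 hp
          -- The last step is one of the steps taken before the level was reached, so it is at most
          -- their sum, whose mean is computed by Wald's identity.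
          refine le_trans ?_ (ENNReal.le_tsum (firstIdx 1 p - 1))
          rw [Set.indicator_of_mem]
          intro i hi1 hi2
          refine hmem.2.2 i ?_ hi2
          have := hmem.1
          omega
    _ = ∑' j, ∫⁻ p, (notHit j).indicator (fun p => ENNReal.ofReal (p.2 j)) p
            ∂(τ.prod (iidLaw ν)) := (lintegral_tsum fun j => ((ENNReal.measurable_ofReal.comp
          ((measurable_pi_apply j).comp measurable_snd)).indicator
            (measurableSet_notHit j)).aemeasurable)
    _ = (∑' j, τ.prod (iidLaw ν) (notHit j)) * ∫⁻ a, ENNReal.ofReal a ∂ν := by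
          rw [← ENNReal.tsum_mul_right]
          exact tsum_congr fun j => setLIntegral_apply τ ν j (measurableSet_notHit j)
            (trunc_mem_notHit j) ENNReal.measurable_ofReal
    _ < ⊤ := ENNReal.mul_lt_top (tsum_notHit_lt_top τ ν hτ0 hτ h0 hpos hg) hi.lintegral_lt_top

end law

end GG11

/-! ### Laws of large numbers for regenerative maps. -/

theorem MeasureTheory.MeasurePreserving.indepFun_comp {α β γ δ : Type*} [MeasurableSpace α]
    [MeasurableSpace β] [MeasurableSpace γ] [MeasurableSpace δ] {μ : Measure α} {ν : Measure β}
    {s : α → β} (hs : MeasurePreserving s μ ν) {f : β → γ} {g : β → δ} (hf : Measurable f)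
    (hg : Measurable g) (h : IndepFun f g ν) : IndepFun (f ∘ s) (g ∘ s) μ := by
  rw [indepFun_iff_measure_inter_preimage_eq_mul] at h ⊢
  intro A B hA hB
  have := h A B hA hB
  rw [← hs.measure_preimage ((hf hA).inter (hg hB)).nullMeasurableSet,
    ← hs.measure_preimage (hf hA).nullMeasurableSet,
    ← hs.measure_preimage (hg hB).nullMeasurableSet] at this
  exact this

section regenerative

variable {E S : Type*} [MeasurableSpace E] [MeasurableSpace S] {π : Measure E}
  [IsProbabilityMeasure π] {κ : Measure S} [IsProbabilityMeasure κ] {c : E → S} {θ : E → E}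

theorem indepFun_of_measurePreserving_prodMk
    (h : MeasurePreserving (fun w => (c w, θ w)) π (κ.prod π)) : IndepFun c θ π := by
  have hc : MeasurePreserving c π κ := measurePreserving_fst.comp h
  have hθ : MeasurePreserving θ π π := measurePreserving_snd.comp h
  rw [indepFun_iff_map_prod_eq_prod_map_map hc.measurable.aemeasurable hθ.measurable.aemeasurable,
    h.map_eq, hc.map_eq, hθ.map_eq]

/-- Pairs of blocks regenerate under `θ ∘ θ`, which reduces functions of two blocks to functions of
one. -/
theorem measurePreserving_prodMk_prodMk
    (h : MeasurePreserving (fun w => (c w, θ w)) π (κ.prod π)) :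
    MeasurePreserving (fun w => ((c w, c (θ w)), θ (θ w))) π ((κ.prod κ).prod π) :=
  (MeasurePreserving.symm MeasurableEquiv.prodAssoc (measurePreserving_prodAssoc κ κ π)).comp
    (((MeasurePreserving.id κ).prod h).comp h)

/-- The strong law of large numbers for a map `θ` that renews the state independently of `c`. -/
theorem tendsto_average_of_regenerative
    (h : MeasurePreserving (fun w => (c w, θ w)) π (κ.prod π)) {g : S → ℝ} (hg : Measurable g)
    (hi : Integrable (fun w => g (c w)) π) :
    ∀ᵐ w ∂π, Tendsto (fun n : ℕ => (∑ j ∈ Finset.range n, g (c (θ^[j] w))) / n) atTop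
      (𝓝 (∫ w, g (c w) ∂π)) := by
  have hc : Measurable c := (measurePreserving_fst.comp h).measurable
  have hθ : MeasurePreserving θ π π := measurePreserving_snd.comp h
  have hgc : Measurable fun w => g (c w) := hg.comp hc
  -- Pairwise independence is all that the strong law requires. Block 0 is independent of `θ w`,
  -- hence of every later block; preservation of `π` by `θ^[i]` carries this to block `i`.
  have hlt : ∀ i j : ℕ, i < j →
      IndepFun (fun w => g (c (θ^[i] w))) (fun w => g (c (θ^[j] w))) π := by
    intro i j hij
    obtain ⟨l, rfl⟩ := Nat.exists_eq_add_of_lt hij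
    have h1 : IndepFun (fun w => g (c w)) (fun w => g (c (θ^[l] (θ w)))) π :=
      (indepFun_of_measurePreserving_prodMk h).comp hg (hgc.comp (hθ.iterate l).measurable)
    have h2 := (hθ.iterate i).indepFun_comp hgc
      (hgc.comp ((hθ.iterate l).measurable.comp hθ.measurable)) h1
    have e : (fun w => g (c (θ^[i + l + 1] w))) = fun w => g (c (θ^[l] (θ (θ^[i] w)))) := by
      funext w
      rw [← Function.iterate_succ_apply, ← Function.iterate_add_apply]
      congr 3
      omega
    rw [e]
    exact h2
  exact strong_law_ae_real (fun j w => g (c (θ^[j] w))) hi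
    (fun i j hij => hij.lt_or_gt.elim (hlt i j) fun h => (hlt j i h).symm)
    fun i => ⟨(hgc.comp (hθ.iterate i).measurable).aemeasurable, hgc.aemeasurable, by
      rw [show (fun w => g (c (θ^[i] w))) = (fun w => g (c w)) ∘ θ^[i] from rfl,
        ← Measure.map_map hgc (hθ.iterate i).measurable, (hθ.iterate i).map_eq]
      rfl⟩

/-- The strong law for functions of two consecutive blocks, over even numbers of blocks. -/
theorem tendsto_average_two_blocks
    (h : MeasurePreserving (fun w => (c w, θ w)) π (κ.prod π)) {g : S × S → ℝ} (hg : Measurable g)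
    (hi : Integrable (fun w => g (c w, c (θ w))) π) :
    ∀ᵐ w ∂π, Tendsto
      (fun n : ℕ => (∑ j ∈ Finset.range (2 * n), g (c (θ^[j] w), c (θ^[j + 1] w))) / n) atTop
      (𝓝 (2 * ∫ w, g (c w, c (θ w)) ∂π)) := by
  have hθ : MeasurePreserving θ π π := measurePreserving_snd.comp h
  have hlln := tendsto_average_of_regenerative (measurePreserving_prodMk_prodMk h) hg hi
  -- Consecutive pairs overlap and are not independent. Those starting at even indices are handled
  -- from `w`, those at odd indices from `θ w`.
  filter_upwards [hlln, hθ.quasiMeasurePreserving.ae hlln] with w h1 h2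
  have h3 := h1.add h2
  rw [← two_mul] at h3
  refine h3.congr fun n => ?_
  rw [← add_div]
  congr 1
  have hit : ∀ j, (fun w => θ (θ w))^[j] = θ^[2 * j] := fun j => by
    rw [Function.iterate_mul]; rfl
  simp only [hit, ← Function.iterate_succ_apply' θ, ← Function.iterate_succ_apply θ]
  induction n with
  | zero => simp
  | succ n ih =>
    rw [Finset.sum_range_succ, Finset.sum_range_succ, mul_add_one, Finset.sum_range_succ,
      Finset.sum_range_succ, ← ih]
    ring

end regenerative

/-! ### Regeneration at accepted packets. -/

namespace GG11

/-- The inter-arrival times and service times seen by the next packet. -/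
noncomputable def advance (w : (ℕ → ℝ) × (ℕ → ℝ)) : (ℕ → ℝ) × (ℕ → ℝ) :=
  (shift (firstIdx 1 (w.2 0, w.1)) w.1, shift 1 w.2)

/-- The service time of the current packet and the idle time after it. -/
noncomputable def firstCycle (w : (ℕ → ℝ) × (ℕ → ℝ)) : ℝ × ℝ := cycle (w.2 0, w.1)

section law

variable (ν : Measure ℝ) [IsProbabilityMeasure ν] (μ : Measure ℝ) [IsProbabilityMeasure μ]

theorem measurePreserving_head_tail :
    MeasurePreserving (fun x : ℕ → ℝ => (x 0, shift 1 x)) (iidLaw μ) (μ.prod (iidLaw μ)) := by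
  have h0 : Measurable fun x : ℕ → ℝ => x 0 := measurable_pi_apply 0
  have h := (indepFun_trunc_shift μ 1).comp h0 measurable_id
  have e : (fun x : ℕ → ℝ => x 0) ∘ trunc 1 = fun x => x 0 := by
    ext x; simp [trunc]
  rw [e] at h
  refine ⟨(measurable_pi_apply 0).prodMk (measurable_shift 1), ?_⟩
  have h2 := h.map_prod_eq_prod_map_map (measurable_pi_apply 0).aemeasurable
    (measurable_shift 1).aemeasurable
  rw [(measurePreserving_eval_infinitePi (fun _ : ℕ => μ) 0).map_eq] at h2
  exact h2.trans (by rw [(measurePreserving_shift μ 1).map_eq])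

theorem measurePreserving_head :
    MeasurePreserving (fun w : (ℕ → ℝ) × (ℕ → ℝ) => ((w.2 0, w.1), shift 1 w.2))
      ((iidLaw ν).prod (iidLaw μ)) ((μ.prod (iidLaw ν)).prod (iidLaw μ)) :=
  (Measure.measurePreserving_swap.prod (MeasurePreserving.id (iidLaw μ))).comp
    ((MeasurePreserving.symm MeasurableEquiv.prodAssoc
      (measurePreserving_prodAssoc (iidLaw ν) μ (iidLaw μ))).comp
      ((MeasurePreserving.id (iidLaw ν)).prod (measurePreserving_head_tail μ)))

/-- The service time of the current packet is the level to be reached by the arrivals; the later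
service times are independent of both and are carried along. -/
theorem measurePreserving_firstCycle_advance (hg : ∀ᵐ z ∂iidLaw ν, Good z) :
    MeasurePreserving (fun w => (firstCycle w, advance w)) ((iidLaw ν).prod (iidLaw μ))
      (((μ.prod (iidLaw ν)).map cycle).prod ((iidLaw ν).prod (iidLaw μ))) := by
  have := Measure.isProbabilityMeasure_map (μ := μ.prod (iidLaw ν)) measurable_cycle.aemeasurable
  exact (measurePreserving_prodAssoc _ _ _).comp
    (((measurePreserving_cycle_shift μ ν hg).prod (MeasurePreserving.id (iidLaw μ))).comp
      (measurePreserving_head ν μ))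

theorem measurePreserving_advance (hg : ∀ᵐ z ∂iidLaw ν, Good z) :
    MeasurePreserving advance ((iidLaw ν).prod (iidLaw μ)) ((iidLaw ν).prod (iidLaw μ)) := by
  have := Measure.isProbabilityMeasure_map (μ := μ.prod (iidLaw ν)) measurable_cycle.aemeasurable
  exact measurePreserving_snd.comp (measurePreserving_firstCycle_advance ν μ hg)

end law

end GG11

/-! ### Sample paths of the system. -/

namespace GG11

variable {Ω : Type*}

/-- The inter-arrival times from the arrival of packet `k` on, and the service times from packet `k`
on. -/
noncomputable def state (q : GG11 Ω) (k : ℕ) (ω : Ω) : (ℕ → ℝ) × (ℕ → ℝ) :=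
  (shift (q.N k ω) fun n => q.Z n ω, shift k fun n => q.X n ω)

section pathwise

variable {q : GG11 Ω} {ω : Ω}

theorem S_eq (n : ℕ) : q.S n ω = q.F ω + psum (fun n => q.Z n ω) n := rfl

theorem S_add (i j : ℕ) :
    q.S (i + j) ω = q.S i ω + psum (shift i fun n => q.Z n ω) j := by
  rw [S_eq, S_eq, psum_add, add_assoc]

theorem N_zero : q.N 0 ω = firstIdx 0 (q.D ω - q.F ω, fun n => q.Z n ω) := by
  simp only [N, firstIdx, S_eq, sub_le_iff_le_add', Nat.zero_le, true_and]

/-- Counting time and arrivals from the arrival of packet `k` turns acceptance of the next packet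
into first passage over its service time. -/
theorem N_succ (hz : Good fun n => q.Z n ω) (k : ℕ) :
    q.N (k + 1) ω = q.N k ω + firstIdx 1 ((q.state k ω).2 0, (q.state k ω).1) := by
  have hmem := mem_hitSet_firstIdx 1 (p := ((q.state k ω).2 0, (q.state k ω).1))
    (hz.shift (q.N k ω))
  have hcond : ∀ j, q.S (q.N k ω) ω + q.X k ω ≤ q.S (q.N k ω + j) ω ↔
      (q.state k ω).2 0 ≤ psum (q.state k ω).1 j := fun j => by
    rw [S_add, add_le_add_iff_left]; rfl
  set j := firstIdx 1 ((q.state k ω).2 0, (q.state k ω).1)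
  have hj : q.N k ω + j ∈ {n | q.N k ω < n ∧ q.S (q.N k ω) ω + q.X k ω ≤ q.S n ω} :=
    ⟨Nat.lt_add_of_pos_right hmem.1, (hcond j).2 hmem.2.1⟩
  refine le_antisymm (Nat.sInf_le hj) (not_lt.1 fun hlt => ?_)
  have h := Nat.sInf_mem ⟨_, hj⟩
  obtain ⟨i, hi⟩ := Nat.exists_eq_add_of_lt h.1
  have hi' : q.N (k + 1) ω = q.N k ω + (i + 1) := hi
  have h2 : q.S (q.N k ω) ω + q.X k ω ≤ q.S (q.N (k + 1) ω) ω := h.2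
  rw [hi', hcond] at h2
  exact absurd h2 (not_le.2 (hmem.2.2 (i + 1) (by omega) (by omega)))

theorem state_succ (hz : Good fun n => q.Z n ω) (k : ℕ) :
    q.state (k + 1) ω = advance (q.state k ω) := by
  refine Prod.ext ?_ ?_
  · ext i
    simp only [advance, state, shift, N_succ hz k, add_assoc]
  · ext i
    simp only [advance, state, shift, add_assoc]

theorem state_eq_iterate (hz : Good fun n => q.Z n ω) (i j : ℕ) :
    q.state (i + j) ω = advance^[j] (q.state i ω) := by
  induction j with
  | zero => rfl
  | succ j ih => rw [Function.iterate_succ_apply', ← ih, ← state_succ hz, add_assoc]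

theorem X_eq (k : ℕ) : q.X k ω = (firstCycle (q.state k ω)).1 := rfl

theorem idle_eq (hz : Good fun n => q.Z n ω) (k : ℕ) :
    q.idle (k + 1) ω = (firstCycle (q.state k ω)).2 := by
  rw [idle, TD, Nat.add_sub_cancel, TA, TA, N_succ hz, S_add, X_eq]
  change _ = _ - (firstCycle (q.state k ω)).1
  simp only [state]
  ring

theorem Zcheck_eq (hz : Good fun n => q.Z n ω) (k : ℕ) :
    q.Zcheck (k + 1) ω =
      (q.state k ω).1 (firstIdx 1 ((q.state k ω).2 0, (q.state k ω).1) - 1) := by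
  have h := (mem_hitSet_firstIdx 1 (p := ((q.state k ω).2 0, (q.state k ω).1))
    (hz.shift (q.N k ω))).1
  rw [Zcheck, N_succ hz]
  obtain ⟨j, hj⟩ := Nat.exists_eq_add_of_le h
  rw [hj, Nat.add_sub_cancel_left, show q.N k ω + (1 + j) - 1 = q.N k ω + j by omega,
    S_add, S_add, add_comm 1 j, psum, Finset.sum_range_succ, psum]
  simp only [state]
  ring

theorem idle_nonneg (hz : Good fun n => q.Z n ω) (k : ℕ) : 0 ≤ q.idle (k + 1) ω := by
  have h := (mem_hitSet_firstIdx 1 (p := ((q.state k ω).2 0, (q.state k ω).1))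
    (hz.shift (q.N k ω))).2.1
  rw [idle_eq hz]
  exact sub_nonneg.2 h

theorem Zcheck_nonneg (hz : Good fun n => q.Z n ω) (k : ℕ) : 0 ≤ q.Zcheck (k + 1) ω := by
  rw [Zcheck_eq hz]
  exact hz.1 _

/-- The arrival preceding packet `k + 1` is either packet `k` or a discarded one; in both cases it
is no later than the departure of packet `k`. -/
theorem idle_le_Zcheck (hz : Good fun n => q.Z n ω) (hx : ∀ k, 0 ≤ q.X k ω) (k : ℕ) :
    q.idle (k + 1) ω ≤ q.Zcheck (k + 1) ω := by
  have h := mem_hitSet_firstIdx 1 (p := ((q.state k ω).2 0, (q.state k ω).1))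
    (hz.shift (q.N k ω))
  rw [idle_eq hz, Zcheck_eq hz, firstCycle, cycle]
  obtain ⟨j, hj⟩ := Nat.exists_eq_add_of_le h.1
  have h2 := h.2.2 j (by omega)
  rw [hj, Nat.add_sub_cancel_left, add_comm 1 j, psum, Finset.sum_range_succ, ← psum]
  -- `hitSet 1` says nothing about index 0, which is packet `k` itself; there non-negativity of the
  -- service time is used.
  have h3 : psum (q.state k ω).1 j ≤ (q.state k ω).2 0 := by
    rcases Nat.eq_zero_or_pos j with rfl | hpos
    · exact (Finset.sum_range_zero _).le.trans (hx k)
    · exact (h2 hpos).le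
  simp only
  linarith

theorem TD_succ (k : ℕ) : q.TD (k + 1) ω = q.TD k ω + (q.X (k + 1) ω + q.idle (k + 1) ω) := by
  rw [idle, Nat.add_sub_cancel, TD, TD]; ring

theorem TD_le_TA_succ (hz : Good fun n => q.Z n ω) (k : ℕ) : q.TD k ω ≤ q.TA (k + 1) ω := by
  have := idle_nonneg hz k
  rw [idle, Nat.add_sub_cancel] at this
  linarith

theorem F_le_TA (hz : Good fun n => q.Z n ω) (k : ℕ) : q.F ω ≤ q.TA k ω := by
  rw [TA, S_eq]
  have : 0 ≤ psum (fun n => q.Z n ω) (q.N k ω) := Finset.sum_nonneg fun i _ => hz.1 i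
  linarith

theorem monotone_TA (hz : Good fun n => q.Z n ω) (hx : ∀ k, 0 ≤ q.X k ω) :
    Monotone fun k => q.TA k ω :=
  monotone_nat_of_le_succ fun k => le_trans (by rw [TD]; linarith [hx k]) (TD_le_TA_succ hz k)

theorem monotone_TD (hz : Good fun n => q.Z n ω) (hx : ∀ k, 0 ≤ q.X k ω) :
    Monotone fun k => q.TD k ω :=
  monotone_nat_of_le_succ fun k => by rw [TD_succ]; linarith [hx (k + 1), idle_nonneg hz k]

/-- Between two successive departures the age is measured from the arrival of the former packet. -/
theorem aoi_eq (hz : Good fun n => q.Z n ω) (hx : ∀ k, 0 ≤ q.X k ω)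
    (hi : q.U ω ≤ q.A ω ∧ q.A ω ≤ 0 ∧ q.A ω ≤ q.D ω ∧ 0 ≤ q.F ω) {k : ℕ} {t : ℝ}
    (h1 : q.TD k ω ≤ t) (h2 : t < q.TD (k + 1) ω) : q.aoi t ω = t - q.TA k ω := by
  rw [aoi]
  congr 1
  refine IsGreatest.csSup_eq ⟨Or.inr ⟨k, rfl, h1⟩, ?_⟩
  have hF := F_le_TA hz k
  -- Packets from before time 0 arrived by time `0 ≤ F ≤ TA k`; a packet `j > k` cannot have left by
  -- `t`, as departures are ordered.
  rintro a ((rfl | ⟨rfl, _⟩) | ⟨j, rfl, hj⟩)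
  · linarith
  · linarith
  · refine monotone_TA hz hx (not_lt.1 fun hlt => ?_)
    have := monotone_TD hz hx (Nat.succ_le_of_lt hlt)
    simp only [Nat.succ_eq_add_one] at this
    linarith

end pathwise

/-! ### The law of the state seen by a packet. -/

section law

variable [MeasurableSpace Ω] {P : Measure Ω} {q : GG11 Ω}

/-- The stationary law of the inter-arrival times and service times. -/
noncomputable def stateLaw (P : Measure Ω) (q : GG11 Ω) : Measure ((ℕ → ℝ) × (ℕ → ℝ)) :=
  (iidLaw (P.map (q.Z 0))).prod (iidLaw (P.map (q.X 0)))

namespace IsGIGI11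

theorem measurable_Zseq (hq : q.IsGIGI11 P) : Measurable fun ω n => q.Z n ω :=
  measurable_pi_lambda _ hq.measurable_Z

theorem measurable_Xseq (hq : q.IsGIGI11 P) : Measurable fun ω n => q.X n ω :=
  measurable_pi_lambda _ hq.measurable_X

theorem ae_nonneg_law_Z (hq : q.IsGIGI11 P) : ∀ᵐ a ∂P.map (q.Z 0), 0 ≤ a :=
  (ae_map_iff (hq.measurable_Z 0).aemeasurable measurableSet_Ici).2 (hq.Z_nonneg 0)

theorem ae_nonneg_law_X (hq : q.IsGIGI11 P) : ∀ᵐ a ∂P.map (q.X 0), 0 ≤ a :=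
  (ae_map_iff (hq.measurable_X 0).aemeasurable measurableSet_Ici).2 (hq.X_nonneg 0)

theorem integrable_law_Z (hq : q.IsGIGI11 P) : Integrable (fun a => a) (P.map (q.Z 0)) :=
  (integrable_map_measure (by fun_prop) (hq.measurable_Z 0).aemeasurable).2 hq.Z_integrable

theorem integrable_law_X (hq : q.IsGIGI11 P) : Integrable (fun a => a) (P.map (q.X 0)) :=
  (integrable_map_measure (by fun_prop) (hq.measurable_X 0).aemeasurable).2 hq.X_integrable

theorem integral_law_Z_pos (hq : q.IsGIGI11 P) : 0 < ∫ a, a ∂P.map (q.Z 0) := by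
  rw [integral_map (hq.measurable_Z 0).aemeasurable (by fun_prop)]
  exact hq.Z_mean_pos

theorem ae_X_nonneg (hq : q.IsGIGI11 P) : ∀ᵐ ω ∂P, ∀ k, 0 ≤ q.X k ω :=
  ae_all_iff.2 hq.X_nonneg

theorem measurable_S (hq : q.IsGIGI11 P) (n : ℕ) : Measurable (q.S n) :=
  hq.measurable_F.add ((measurable_psum n).comp hq.measurable_Zseq)

theorem measurable_N (hq : q.IsGIGI11 P) (k : ℕ) : Measurable (q.N k) := by
  induction k with
  | zero => exact measurable_sInf_nat fun n => measurableSet_le hq.measurable_D (hq.measurable_S n)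
  | succ k ih =>
    refine measurable_sInf_nat fun n => MeasurableSet.inter (measurableSet_lt ih measurable_const) ?_
    exact measurableSet_le ((measurable_comp_index hq.measurable_S ih).add (hq.measurable_X k))
      (hq.measurable_S n)

theorem measurable_TA (hq : q.IsGIGI11 P) (k : ℕ) : Measurable (q.TA k) :=
  measurable_comp_index hq.measurable_S (hq.measurable_N k)

theorem measurable_TD (hq : q.IsGIGI11 P) (k : ℕ) : Measurable (q.TD k) :=
  (hq.measurable_TA k).add (hq.measurable_X k)

theorem measurable_idle (hq : q.IsGIGI11 P) (k : ℕ) : Measurable (q.idle k) :=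
  (hq.measurable_TA k).sub (hq.measurable_TD (k - 1))

theorem measurable_Zcheck (hq : q.IsGIGI11 P) (k : ℕ) : Measurable (q.Zcheck k) :=
  (hq.measurable_TA k).sub (measurable_comp_index (f := fun n => q.S (n - 1))
    (fun n => hq.measurable_S (n - 1)) (hq.measurable_N k))

theorem measurable_gammaStar (hq : q.IsGIGI11 P) (d : ℝ) (k : ℕ) :
    Measurable (q.gammaStar d k) := by
  have := hq.measurable_idle k
  have := hq.measurable_X
  unfold gammaStar
  fun_prop

theorem measurable_Gamma1 (hq : q.IsGIGI11 P) (d : ℝ) (k : ℕ) : Measurable (q.Gamma1 d k) := by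
  have := hq.measurable_Zcheck k
  have := hq.measurable_X
  unfold Gamma1
  fun_prop

theorem measurable_state (hq : q.IsGIGI11 P) (k : ℕ) : Measurable (q.state k) :=
  (measurable_comp_index (f := fun n ω => shift n fun i => q.Z i ω)
    (fun n => (measurable_shift n).comp hq.measurable_Zseq) (hq.measurable_N k)).prodMk
    ((measurable_shift k).comp hq.measurable_Xseq)

theorem measurePreserving_Z (hq : q.IsGIGI11 P) :
    MeasurePreserving (fun ω n => q.Z n ω) P (iidLaw (P.map (q.Z 0))) := by
  refine ⟨hq.measurable_Zseq, ?_⟩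
  rw [hq.Z_indep.map_fun_eq_infinitePi_map hq.measurable_Z]
  congr 1
  funext n
  exact (hq.Z_ident n).map_eq

theorem measurePreserving_X (hq : q.IsGIGI11 P) :
    MeasurePreserving (fun ω n => q.X n ω) P (iidLaw (P.map (q.X 0))) := by
  refine ⟨hq.measurable_Xseq, ?_⟩
  rw [hq.X_indep.map_fun_eq_infinitePi_map hq.measurable_X]
  congr 1
  funext n
  exact (hq.X_ident n).map_eq

variable [IsProbabilityMeasure P]

theorem isProbabilityMeasure_Z (hq : q.IsGIGI11 P) : IsProbabilityMeasure (P.map (q.Z 0)) :=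
  Measure.isProbabilityMeasure_map (hq.measurable_Z 0).aemeasurable

theorem isProbabilityMeasure_X (hq : q.IsGIGI11 P) : IsProbabilityMeasure (P.map (q.X 0)) :=
  Measure.isProbabilityMeasure_map (hq.measurable_X 0).aemeasurable

theorem isProbabilityMeasure_stateLaw (hq : q.IsGIGI11 P) :
    IsProbabilityMeasure (stateLaw P q) := by
  have := hq.isProbabilityMeasure_Z
  have := hq.isProbabilityMeasure_X
  unfold stateLaw
  infer_instance

theorem measurePreserving_ZX (hq : q.IsGIGI11 P) :
    MeasurePreserving (fun ω => ((fun n => q.Z n ω), (fun n => q.X n ω))) P (stateLaw P q) := by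
  refine ⟨hq.measurable_Zseq.prodMk hq.measurable_Xseq, ?_⟩
  rw [hq.ZX_indep.map_prod_eq_prod_map_map hq.measurable_Zseq.aemeasurable
    hq.measurable_Xseq.aemeasurable, hq.measurePreserving_Z.map_eq, hq.measurePreserving_X.map_eq,
    stateLaw]

theorem ae_good_law (hq : q.IsGIGI11 P) : ∀ᵐ z ∂iidLaw (P.map (q.Z 0)), Good z := by
  have := hq.isProbabilityMeasure_Z
  exact ae_good _ hq.ae_nonneg_law_Z hq.integrable_law_Z hq.integral_law_Z_pos

theorem ae_good (hq : q.IsGIGI11 P) : ∀ᵐ ω ∂P, Good fun n => q.Z n ω :=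
  hq.measurePreserving_Z.quasiMeasurePreserving.ae hq.ae_good_law

/-- The first accepted arrival is a first passage over `D - F`, a level independent of both
sequences, so whatever the initial law, packet 0 sees fresh i.i.d. sequences. -/
theorem measurePreserving_state_zero (hq : q.IsGIGI11 P) :
    MeasurePreserving (q.state 0) P (stateLaw P q) := by
  have := hq.isProbabilityMeasure_Z
  have := hq.isProbabilityMeasure_X
  have hDF : Measurable fun ω => q.D ω - q.F ω := hq.measurable_D.sub hq.measurable_F
  have := Measure.isProbabilityMeasure_map (μ := P) hDF.aemeasurable
  have hind : IndepFun (fun ω => q.D ω - q.F ω)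
      (fun ω => ((fun n => q.Z n ω), (fun n => q.X n ω))) P :=
    hq.init_indep.comp (φ := fun p : ℝ × ℝ × ℝ × ℝ => p.2.2.1 - p.1) (ψ := id)
      (by fun_prop) measurable_id
  have h1 : MeasurePreserving
      (fun ω => (q.D ω - q.F ω, ((fun n => q.Z n ω), (fun n => q.X n ω)))) P
      ((P.map fun ω => q.D ω - q.F ω).prod (stateLaw P q)) := by
    refine ⟨hDF.prodMk (hq.measurable_Zseq.prodMk hq.measurable_Xseq), ?_⟩
    rw [hind.map_prod_eq_prod_map_map hDF.aemeasurable
      (hq.measurable_Zseq.prodMk hq.measurable_Xseq).aemeasurable, hq.measurePreserving_ZX.map_eq]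
  have h2 := (MeasurePreserving.symm MeasurableEquiv.prodAssoc
    (measurePreserving_prodAssoc (P.map fun ω => q.D ω - q.F ω) (iidLaw (P.map (q.Z 0)))
      (iidLaw (P.map (q.X 0))))).comp h1
  have h3 := ((measurePreserving_shift_firstIdx (P.map fun ω => q.D ω - q.F ω) (P.map (q.Z 0))
    hq.ae_good_law 0).prod (MeasurePreserving.id (iidLaw (P.map (q.X 0))))).comp h2
  have e : q.state 0 = fun ω => (shift (firstIdx 0 (q.D ω - q.F ω, fun n => q.Z n ω))
      (fun n => q.Z n ω), fun n => q.X n ω) := by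
    funext ω
    refine Prod.ext ?_ ?_
    · simp only [state, N_zero]
    · ext i
      simp [state, shift]
  rw [e]
  exact h3

theorem measurePreserving_state (hq : q.IsGIGI11 P) (k : ℕ) :
    MeasurePreserving (q.state k) P (stateLaw P q) := by
  have := hq.isProbabilityMeasure_Z
  have := hq.isProbabilityMeasure_X
  induction k with
  | zero => exact hq.measurePreserving_state_zero
  | succ k ih =>
    refine ⟨hq.measurable_state _, ?_⟩
    refine Eq.trans ?_ ((measurePreserving_advance _ _ hq.ae_good_law).comp ih).map_eq
    refine Measure.map_congr ?_
    filter_upwards [hq.ae_good] with ω hω using state_succ hω k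

end IsGIGI11

end law

end GG11

/-! ### Deterministic lemmas on time averages. -/

/-- If the integral of a bounded function grows linearly along `s` and `s` grows linearly, the
long-run average of the function is the quotient of the two rates. -/
theorem tendsto_integral_div_of_subsequence {v : ℝ → ℝ} (hv : Measurable v)
    (h1 : ∀ t, ‖v t‖ ≤ 1) {s : ℕ → ℝ} {c γ : ℝ} (hc : 0 < c)
    (hs : Tendsto (fun n : ℕ => s n / n) atTop (𝓝 c))
    (hγ : Tendsto (fun n : ℕ => (∫ t in (0 : ℝ)..s n, v t) / n) atTop (𝓝 γ)) :
    Tendsto (fun n : ℕ => (∫ t in (0 : ℝ)..n, v t) / n) atTop (𝓝 (γ / c)) := by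
  have hint : ∀ a b, IntervalIntegrable v volume a b := fun a b =>
    (intervalIntegrable_const (c := (1 : ℝ))).mono_fun hv.aestronglyMeasurable
      (ae_of_all _ fun t => by simpa using h1 t)
  -- Evaluating along the index `⌊n / c⌋` places `s` at `n + o(n)`; the integral over the remaining
  -- stretch is `o(n)` since `v` is bounded by 1.
  have hfl : Tendsto (fun n : ℕ => (⌊c⁻¹ * (n : ℝ)⌋₊ : ℝ) / n) atTop (𝓝 c⁻¹) :=
    (tendsto_nat_floor_mul_div_atTop (R := ℝ) (inv_nonneg.2 hc.le)).comp tendsto_natCast_atTop_atTop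
  have hk : Tendsto (fun n : ℕ => ⌊c⁻¹ * (n : ℝ)⌋₊) atTop atTop :=
    tendsto_nat_floor_atTop.comp
      (tendsto_natCast_atTop_atTop.const_mul_atTop (inv_pos.2 hc))
  have hmul : ∀ {f : ℕ → ℝ} {l : ℝ}, Tendsto (fun n : ℕ => f n / n) atTop (𝓝 l) →
      Tendsto (fun n : ℕ => f ⌊c⁻¹ * (n : ℝ)⌋₊ / n) atTop (𝓝 (l * c⁻¹)) := by
    intro f l hf
    refine ((hf.comp hk).mul hfl).congr' ?_
    filter_upwards [hk.eventually_gt_atTop 0] with n hn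
    have : (⌊c⁻¹ * (n : ℝ)⌋₊ : ℝ) ≠ 0 := by exact_mod_cast hn.ne'
    simp only [Function.comp_apply]
    rw [div_mul_div_comm, mul_comm (f _), mul_div_mul_left _ _ this]
  have hsn := hmul hs
  rw [mul_inv_cancel₀ hc.ne'] at hsn
  have hrem : Tendsto (fun n : ℕ => (∫ t in s ⌊c⁻¹ * (n : ℝ)⌋₊..n, v t) / n) atTop (𝓝 0) := by
    have h0 : Tendsto (fun n : ℕ => |1 - s ⌊c⁻¹ * (n : ℝ)⌋₊ / n|) atTop (𝓝 0) := by
      have := (tendsto_const_nhds (x := (1 : ℝ))).sub hsn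
      rw [sub_self] at this
      simpa using this.abs
    refine squeeze_zero_norm' ?_ h0
    filter_upwards [eventually_gt_atTop 0] with n hn
    have hn' : (0 : ℝ) < n := by exact_mod_cast hn
    have hb := intervalIntegral.norm_integral_le_of_norm_le_const (f := v) (C := 1)
      (a := s ⌊c⁻¹ * (n : ℝ)⌋₊) (b := n) fun t _ => h1 t
    rw [norm_div, Real.norm_of_nonneg hn'.le, div_le_iff₀ hn', ← abs_of_pos hn', ← abs_mul,
      abs_of_pos hn', sub_mul, div_mul_cancel₀ _ hn'.ne', one_mul]
    rwa [one_mul] at hb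
  have h := (hmul hγ).add hrem
  rw [add_zero, ← div_eq_mul_inv] at h
  refine h.congr fun n => ?_
  rw [← add_div, intervalIntegral.integral_add_adjacent_intervals (hint _ _) (hint _ _)]

/-- Averages of a bounded function over `[0, n]` converge to its limit at infinity. -/
theorem tendsto_average_of_tendsto {u : ℝ → ℝ} (hu : Measurable u) (h1 : ∀ t, ‖u t‖ ≤ 1) {p : ℝ}
    (h : Tendsto u atTop (𝓝 p)) :
    Tendsto (fun n : ℕ => (∫ t in (0 : ℝ)..n, u t) / n) atTop (𝓝 p) := by
  -- Rescaling to the unit interval allows dominated convergence: for every `x > 0`, `n * x` tends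
  -- to infinity.
  have hlim : Tendsto (fun n : ℕ => ∫ x in (0 : ℝ)..1, u (n * x)) atTop
      (𝓝 (∫ _ in (0 : ℝ)..1, p)) := by
    refine intervalIntegral.tendsto_integral_filter_of_dominated_convergence (fun _ => 1)
      (Eventually.of_forall fun n => (hu.comp (measurable_const_mul _)).aestronglyMeasurable)
      (Eventually.of_forall fun n => ae_of_all _ fun x _ => h1 _) intervalIntegrable_const
      (ae_of_all _ fun x hx => ?_)
    rw [Set.uIoc_of_le zero_le_one] at hx
    exact h.comp (tendsto_natCast_atTop_atTop.atTop_mul_const hx.1)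
  simp only [intervalIntegral.integral_const, sub_zero, one_smul] at hlim
  refine hlim.congr' ?_
  filter_upwards [eventually_gt_atTop 0] with n hn
  have hn' : (n : ℝ) ≠ 0 := by exact_mod_cast hn.ne'
  rw [intervalIntegral.integral_comp_mul_left _ hn', mul_zero, mul_one, smul_eq_mul,
    inv_mul_eq_div]

/-! ### Time spent above the age limit. -/

namespace GG11

variable {Ω : Type*}

/-- The times (after the departure of packet `0`) and outcomes at which the age exceeds `d`. -/
def violation (q : GG11 Ω) (d : ℝ) : Set (ℝ × Ω) :=
  {p | ∃ k, q.TD k p.2 ≤ p.1 ∧ p.1 < q.TD (k + 1) p.2 ∧ d < p.1 - q.TA k p.2}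

section pathwise

variable {q : GG11 Ω} {ω : Ω}

theorem mem_violation_iff (hz : Good fun n => q.Z n ω) (hx : ∀ k, 0 ≤ q.X k ω) {d t : ℝ} {k : ℕ}
    (h1 : q.TD k ω ≤ t) (h2 : t < q.TD (k + 1) ω) :
    (t, ω) ∈ q.violation d ↔ d < t - q.TA k ω := by
  refine ⟨fun ⟨j, hj1, hj2, hj⟩ => ?_, fun h => ⟨k, h1, h2, h⟩⟩
  have hm := monotone_TD hz hx
  rcases lt_trichotomy j k with h | rfl | h
  · exact absurd (hj2.trans_le (hm (Nat.succ_le_of_lt h))) (not_lt.2 h1)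
  · exact hj
  · exact absurd (h2.trans_le (hm (Nat.succ_le_of_lt h))) (not_lt.2 hj1)

/-- In this interval the violation starts at `d + TA k`, or at the departure if the age then is
already at least `d`; the two terms of the minimum in `γ*` are the lengths in these cases. -/
theorem integral_violation_cycle (hz : Good fun n => q.Z n ω) (hx : ∀ k, 0 ≤ q.X k ω) (d : ℝ)
    (k : ℕ) :
    ∫ t in q.TD k ω..q.TD (k + 1) ω, (q.violation d).indicator (fun _ => (1 : ℝ)) (t, ω)
      = q.gammaStar d (k + 1) ω := by
  have hle : q.TD k ω ≤ q.TD (k + 1) ω := monotone_TD hz hx (Nat.le_succ k)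
  rw [intervalIntegral.integral_of_le hle, integral_Ioc_eq_integral_Ioo,
    setIntegral_congr_fun (g := (Set.Ioi (d + q.TA k ω)).indicator fun _ => (1 : ℝ))
      measurableSet_Ioo, setIntegral_indicator measurableSet_Ioi, Set.Ioo_inter_Ioi]
  · have e1 := TD_succ (q := q) (ω := ω) k
    have e2 : q.TD k ω = q.TA k ω + q.X k ω := rfl
    have h0 : 0 ≤ q.X (k + 1) ω + q.idle (k + 1) ω := by linarith
    have e3 : q.X (k + 1) ω + q.X k ω + q.idle (k + 1) ω - d
        = q.TD (k + 1) ω - (d + q.TA k ω) := by linarith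
    have e4 : q.X (k + 1) ω + q.idle (k + 1) ω = q.TD (k + 1) ω - q.TD k ω := by linarith
    rw [gammaStar, Nat.add_sub_cancel, e3, e4]
    simp only [setIntegral_const, Real.volume_real_Ioo, smul_eq_mul, mul_one]
    rw [e4] at h0
    rcases le_total (q.TD k ω) (d + q.TA k ω) with h | h
    · rw [sup_eq_right.2 h, max_comm, min_eq_left]
      exact max_le h0 (by linarith)
    · rw [sup_eq_left.2 h, max_eq_left h0, min_eq_right]
      exact le_max_of_le_right (by linarith)
  · intro t ht
    have h1 : (t, ω) ∈ q.violation d ↔ t ∈ Set.Ioi (d + q.TA k ω) := by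
      rw [mem_violation_iff hz hx ht.1.le ht.2, Set.mem_Ioi, lt_sub_iff_add_lt]
    by_cases h : (t, ω) ∈ q.violation d
    · exact (Set.indicator_of_mem h _).trans (Set.indicator_of_mem (h1.1 h) fun _ => (1 : ℝ)).symm
    · exact (Set.indicator_of_notMem h _).trans
        (Set.indicator_of_notMem (fun h' => h (h1.2 h')) fun _ => (1 : ℝ)).symm

theorem integral_violation (hz : Good fun n => q.Z n ω) (hx : ∀ k, 0 ≤ q.X k ω)
    (h0 : 0 ≤ q.TD 0 ω) (d : ℝ)
    (hm : Measurable fun t => (q.violation d).indicator (fun _ => (1 : ℝ)) (t, ω)) (n : ℕ) :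
    ∫ t in (0 : ℝ)..q.TD n ω, (q.violation d).indicator (fun _ => (1 : ℝ)) (t, ω)
      = ∑ j ∈ Finset.range n, q.gammaStar d (j + 1) ω := by
  have hint : ∀ a b, IntervalIntegrable
      (fun t => (q.violation d).indicator (fun _ => (1 : ℝ)) (t, ω)) volume a b := fun a b =>
    (intervalIntegrable_const (c := (1 : ℝ))).mono_fun hm.aestronglyMeasurable
      (ae_of_all _ fun t => norm_indicator_le_norm_self (fun _ => (1 : ℝ)) _)
  induction n with
  | zero =>
    rw [Finset.sum_range_zero, intervalIntegral.integral_of_le h0, integral_Ioc_eq_integral_Ioo]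
    refine setIntegral_eq_zero_of_forall_eq_zero fun t ht => ?_
    refine Set.indicator_of_notMem ?_ _
    rintro ⟨j, hj, _⟩
    exact absurd (hj.trans_lt ht.2) (not_lt.2 (monotone_TD hz hx (Nat.zero_le j)))
  | succ n ih =>
    rw [Finset.sum_range_succ, ← ih, ← integral_violation_cycle hz hx d n,
      intervalIntegral.integral_add_adjacent_intervals (hint _ _) (hint _ _)]

end pathwise

/-- The time from a departure to the next one, in terms of the two cycles involved. -/
def departureGap (p : (ℝ × ℝ) × (ℝ × ℝ)) : ℝ := p.2.1 + p.1.2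

/-- `γ*` in terms of the two cycles involved. -/
noncomputable def gammaFn (d : ℝ) (p : (ℝ × ℝ) × (ℝ × ℝ)) : ℝ :=
  min (max 0 (p.2.1 + p.1.1 + p.1.2 - d)) (p.2.1 + p.1.2)

/-- The cycle of packet `k` and the next one. -/
noncomputable def cyclePair (q : GG11 Ω) (k : ℕ) (ω : Ω) : (ℝ × ℝ) × (ℝ × ℝ) :=
  (firstCycle (q.state k ω), firstCycle (q.state (k + 1) ω))

theorem departureGap_eq {q : GG11 Ω} {ω : Ω} (hz : Good fun n => q.Z n ω) (k : ℕ) :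
    departureGap (q.cyclePair k ω) = q.X (k + 1) ω + q.idle (k + 1) ω := by
  rw [idle_eq hz, X_eq, departureGap, cyclePair]

theorem gammaFn_eq {q : GG11 Ω} {ω : Ω} (hz : Good fun n => q.Z n ω) (d : ℝ) (k : ℕ) :
    gammaFn d (q.cyclePair k ω) = q.gammaStar d (k + 1) ω := by
  rw [gammaStar, Nat.add_sub_cancel, idle_eq hz, X_eq, X_eq, gammaFn, cyclePair]

theorem measurable_departureGap : Measurable departureGap := by
  unfold departureGap; fun_prop

theorem measurable_gammaFn (d : ℝ) : Measurable (gammaFn d) := by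
  unfold gammaFn; fun_prop

theorem measurable_firstCycle : Measurable firstCycle :=
  measurable_cycle.comp (((measurable_pi_apply 0).comp measurable_snd).prodMk measurable_fst)

namespace IsGIGI11

variable [MeasurableSpace Ω] {P : Measure Ω} {q : GG11 Ω}

theorem integrable_X (hq : q.IsGIGI11 P) (k : ℕ) : Integrable (q.X k) P :=
  (hq.X_ident k).integrable_iff.2 hq.X_integrable

theorem integral_X (hq : q.IsGIGI11 P) (k : ℕ) : ∫ ω, q.X k ω ∂P = ∫ ω, q.X 0 ω ∂P :=
  (hq.X_ident k).integral_eq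

variable [IsProbabilityMeasure P]

/-- The law does not depend on `k`, so limits of averages over all packets can be expressed through
any one packet. -/
theorem measurePreserving_cyclePair (hq : q.IsGIGI11 P) (k : ℕ) :
    MeasurePreserving (q.cyclePair k) P
      ((stateLaw P q).map fun w => (firstCycle w, firstCycle (advance w))) := by
  have := hq.isProbabilityMeasure_Z
  have := hq.isProbabilityMeasure_X
  have hm : Measurable fun w => (firstCycle w, firstCycle (advance w)) :=
    measurable_firstCycle.prodMk (measurable_firstCycle.comp
      (measurePreserving_advance (P.map (q.Z 0)) (P.map (q.X 0)) hq.ae_good_law).measurable)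
  refine ⟨(measurable_firstCycle.comp (hq.measurable_state k)).prodMk
    (measurable_firstCycle.comp (hq.measurable_state (k + 1))), ?_⟩
  rw [← (hq.measurePreserving_state k).map_eq, Measure.map_map hm (hq.measurable_state k)]
  refine Measure.map_congr ?_
  filter_upwards [hq.ae_good] with ω hω
  simp [cyclePair, state_succ hω]

theorem ae_tendsto_average (hq : q.IsGIGI11 P) {g : (ℝ × ℝ) × (ℝ × ℝ) → ℝ} (hg : Measurable g)
    {k : ℕ} (hi : Integrable (fun ω => g (q.cyclePair k ω)) P) :
    ∀ᵐ ω ∂P, Tendsto (fun n : ℕ => (∑ j ∈ Finset.range (2 * n), g (q.cyclePair j ω)) / n) atTop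
      (𝓝 (2 * ∫ ω, g (q.cyclePair k ω) ∂P)) := by
  have := hq.isProbabilityMeasure_Z
  have := hq.isProbabilityMeasure_X
  have := hq.isProbabilityMeasure_stateLaw
  have hm : Measurable fun w => (firstCycle w, firstCycle (advance w)) :=
    measurable_firstCycle.prodMk (measurable_firstCycle.comp
      (measurePreserving_advance (P.map (q.Z 0)) (P.map (q.X 0)) hq.ae_good_law).measurable)
  have := Measure.isProbabilityMeasure_map (μ := (P.map (q.X 0)).prod (iidLaw (P.map (q.Z 0))))
    measurable_cycle.aemeasurable
  have hi' : Integrable (fun w => g (firstCycle w, firstCycle (advance w))) (stateLaw P q) := by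
    have h1 := (hq.measurePreserving_cyclePair k).integrable_comp
      (g := g) hg.aestronglyMeasurable |>.1 hi
    exact (integrable_map_measure hg.aestronglyMeasurable hm.aemeasurable).1 h1
  have h := tendsto_average_two_blocks (π := stateLaw P q) (measurePreserving_firstCycle_advance
    (P.map (q.Z 0)) (P.map (q.X 0)) hq.ae_good_law) hg hi'
  have he : ∫ w, g (firstCycle w, firstCycle (advance w)) ∂stateLaw P q
      = ∫ ω, g (q.cyclePair k ω) ∂P := by
    rw [← integral_map hm.aemeasurable hg.aestronglyMeasurable,
      ← (hq.measurePreserving_cyclePair k).map_eq, integral_map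
      (hq.measurePreserving_cyclePair k).measurable.aemeasurable hg.aestronglyMeasurable]
  rw [he] at h
  filter_upwards [hq.ae_good, (hq.measurePreserving_state 0).quasiMeasurePreserving.ae h]
    with ω hω hlim
  refine hlim.congr fun n => ?_
  congr 1
  refine Finset.sum_congr rfl fun j _ => ?_
  rw [← state_eq_iterate hω, ← state_eq_iterate hω, zero_add, zero_add, cyclePair]

theorem integrable_Zcheck (hq : q.IsGIGI11 P) (k : ℕ) : Integrable (q.Zcheck (k + 1)) P := by
  have := hq.isProbabilityMeasure_Z
  have := hq.isProbabilityMeasure_X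
  have h1 := integrable_last (P.map (q.X 0)) (P.map (q.Z 0)) hq.ae_nonneg_law_X
    hq.integrable_law_X hq.ae_nonneg_law_Z hq.integrable_law_Z hq.integral_law_Z_pos hq.ae_good_law
  have h2 := measurePreserving_fst.comp ((measurePreserving_head (P.map (q.Z 0))
    (P.map (q.X 0))).comp (hq.measurePreserving_state k))
  refine (h2.integrable_comp_of_integrable h1).congr ?_
  filter_upwards [hq.ae_good] with ω hω
  rw [Zcheck_eq hω]
  rfl

theorem integrable_idle (hq : q.IsGIGI11 P) (k : ℕ) : Integrable (q.idle (k + 1)) P := by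
  refine (hq.integrable_Zcheck k).mono' (hq.measurable_idle _).aestronglyMeasurable ?_
  filter_upwards [hq.ae_good, hq.ae_X_nonneg] with ω hω hx
  rw [Real.norm_of_nonneg (idle_nonneg hω k)]
  exact idle_le_Zcheck hω hx k

theorem integrable_gammaStar (hq : q.IsGIGI11 P) (d : ℝ) (k : ℕ) :
    Integrable (q.gammaStar d (k + 1)) P := by
  refine ((hq.integrable_X (k + 1)).add (hq.integrable_idle k)).mono'
    (hq.measurable_gammaStar d _).aestronglyMeasurable ?_
  filter_upwards [hq.ae_good, hq.ae_X_nonneg] with ω hω hx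
  have h0 : 0 ≤ q.gammaStar d (k + 1) ω :=
    le_min (le_max_left _ _) (add_nonneg (hx _) (idle_nonneg hω k))
  rw [Real.norm_of_nonneg h0]
  exact min_le_right _ _

theorem integrable_Gamma1 (hq : q.IsGIGI11 P) (d : ℝ) (k : ℕ) :
    Integrable (q.Gamma1 d (k + 1)) P := by
  refine ((hq.integrable_X (k + 1)).add (hq.integrable_Zcheck k)).mono'
    (hq.measurable_Gamma1 d _).aestronglyMeasurable ?_
  filter_upwards [hq.ae_good, hq.ae_X_nonneg] with ω hω hx
  have h0 : 0 ≤ q.Gamma1 d (k + 1) ω :=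
    le_min (le_max_left _ _) (add_nonneg (hx _) (Zcheck_nonneg hω k))
  rw [Real.norm_of_nonneg h0]
  exact min_le_right _ _

theorem integral_Gamma1_nonneg (hq : q.IsGIGI11 P) (d : ℝ) (k : ℕ) :
    0 ≤ ∫ ω, q.Gamma1 d (k + 1) ω ∂P := by
  refine integral_nonneg_of_ae ?_
  filter_upwards [hq.ae_good, hq.ae_X_nonneg] with ω hω hx
  exact le_min (le_max_left _ _) (add_nonneg (hx _) (Zcheck_nonneg hω k))

theorem integral_gammaStar_le (hq : q.IsGIGI11 P) (d : ℝ) (k : ℕ) :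
    ∫ ω, q.gammaStar d (k + 1) ω ∂P ≤ ∫ ω, q.Gamma1 d (k + 1) ω ∂P := by
  refine integral_mono_ae (hq.integrable_gammaStar d k) (hq.integrable_Gamma1 d k) ?_
  filter_upwards [hq.ae_good, hq.ae_X_nonneg] with ω hω hx
  have h := idle_le_Zcheck hω hx k
  exact min_le_min (max_le_max le_rfl (by linarith)) (by linarith)

theorem integral_cycle_pos (hq : q.IsGIGI11 P) (k : ℕ) :
    0 < ∫ ω, q.X (k + 1) ω ∂P + ∫ ω, q.idle (k + 1) ω ∂P := by
  rw [hq.integral_X]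
  refine add_pos_of_pos_of_nonneg hq.X_mean_pos (integral_nonneg_of_ae ?_)
  filter_upwards [hq.ae_good] with ω hω using idle_nonneg hω k

end IsGIGI11

end GG11

/-! ### From time averages to the violation probability. -/

namespace GG11

variable {Ω : Type*}

theorem exists_TD_le_lt {q : GG11 Ω} {ω : Ω} {t : ℝ} (h0 : q.TD 0 ω ≤ t)
    (h : ∃ j, t < q.TD j ω) : ∃ k, q.TD k ω ≤ t ∧ t < q.TD (k + 1) ω := by
  classical
  have hpos : Nat.find h ≠ 0 := fun he => by
    have := Nat.find_spec h
    rw [he] at this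
    linarith
  obtain ⟨k, hk⟩ := Nat.exists_eq_succ_of_ne_zero hpos
  refine ⟨k, not_lt.1 (Nat.find_min h (by omega)), ?_⟩
  have := Nat.find_spec h
  rwa [hk] at this

namespace IsGIGI11

variable [MeasurableSpace Ω] {P : Measure Ω} {q : GG11 Ω}

theorem measurableSet_violation (hq : q.IsGIGI11 P) (d : ℝ) :
    MeasurableSet (q.violation d) := by
  have hTD : ∀ k, Measurable fun p : ℝ × Ω => q.TD k p.2 :=
    fun k => (hq.measurable_TD k).comp measurable_snd
  have hTA : ∀ k, Measurable fun p : ℝ × Ω => q.TA k p.2 :=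
    fun k => (hq.measurable_TA k).comp measurable_snd
  have : q.violation d = ⋃ k, ({p : ℝ × Ω | q.TD k p.2 ≤ p.1} ∩
      ({p : ℝ × Ω | p.1 < q.TD (k + 1) p.2} ∩ {p : ℝ × Ω | d < p.1 - q.TA k p.2})) := by
    ext p
    simp [violation]
  rw [this]
  exact MeasurableSet.iUnion fun k => (measurableSet_le (hTD k) measurable_fst).inter
    ((measurableSet_lt measurable_fst (hTD (k + 1))).inter
      (measurableSet_lt measurable_const (measurable_fst.sub (hTA k))))

theorem measurable_indicator_violation (hq : q.IsGIGI11 P) (d : ℝ) :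
    Measurable ((q.violation d).indicator fun _ => (1 : ℝ)) :=
  measurable_const.indicator (hq.measurableSet_violation d)

variable [IsProbabilityMeasure P]

theorem ae_TD_zero_nonneg (hq : q.IsGIGI11 P) : ∀ᵐ ω ∂P, 0 ≤ q.TD 0 ω := by
  filter_upwards [hq.ae_good, hq.ae_X_nonneg, hq.init_order] with ω hz hx hi
  exact add_nonneg (hi.2.2.2.trans (F_le_TA hz 0)) (hx 0)

/-- Departures occur at the rate `ν`. -/
theorem ae_tendsto_TD_div (hq : q.IsGIGI11 P) (k : ℕ) :
    ∀ᵐ ω ∂P, Tendsto (fun n : ℕ => q.TD (2 * n) ω / n) atTop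
      (𝓝 (2 * (∫ ω, q.X (k + 1) ω ∂P + ∫ ω, q.idle (k + 1) ω ∂P))) := by
  have hae : (fun ω => departureGap (q.cyclePair k ω)) =ᵐ[P]
      fun ω => q.X (k + 1) ω + q.idle (k + 1) ω := by
    filter_upwards [hq.ae_good] with ω hω using departureGap_eq hω k
  have h := hq.ae_tendsto_average measurable_departureGap (k := k)
    (((hq.integrable_X (k + 1)).add (hq.integrable_idle k)).congr hae.symm)
  rw [integral_congr_ae hae, integral_add (hq.integrable_X (k + 1)) (hq.integrable_idle k)] at h
  filter_upwards [h, hq.ae_good] with ω hlim hω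
  have h0 : Tendsto (fun n : ℕ => q.TD 0 ω / n) atTop (𝓝 0) :=
    tendsto_const_div_atTop_nhds_zero_nat _
  have h1 := h0.add hlim
  rw [zero_add] at h1
  refine h1.congr fun n => ?_
  rw [← add_div]
  congr 1
  induction (2 * n) with
  | zero => simp
  | succ m ih => rw [Finset.sum_range_succ, ← add_assoc, ih, departureGap_eq hω, TD_succ]

/-- Departure times grow linearly, so every time after the first departure lies between two
successive ones. -/
theorem ae_exists_lt_TD (hq : q.IsGIGI11 P) : ∀ᵐ ω ∂P, ∀ t, ∃ j, t < q.TD j ω := by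
  filter_upwards [hq.ae_tendsto_TD_div 0] with ω h t
  have h1 := h.pos_mul_atTop (mul_pos two_pos (hq.integral_cycle_pos 0))
    (tendsto_natCast_atTop_atTop (R := ℝ))
  obtain ⟨n, hn, hn0⟩ := ((h1.eventually_gt_atTop t).and (eventually_gt_atTop 0)).exists
  have : (n : ℝ) ≠ 0 := by exact_mod_cast hn0.ne'
  rw [div_mul_cancel₀ _ this] at hn
  exact ⟨_, hn⟩

/-- The long-run fraction of time during which the age exceeds `d`. -/
theorem ae_tendsto_violation (hq : q.IsGIGI11 P) (d : ℝ) (k : ℕ) :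
    ∀ᵐ ω ∂P, Tendsto (fun n : ℕ => (∫ t in (0 : ℝ)..n,
      (q.violation d).indicator (fun _ => (1 : ℝ)) (t, ω)) / n) atTop
      (𝓝 (q.nu P (k + 1) * ∫ ω, q.gammaStar d (k + 1) ω ∂P)) := by
  have hae : (fun ω => gammaFn d (q.cyclePair k ω)) =ᵐ[P] q.gammaStar d (k + 1) := by
    filter_upwards [hq.ae_good] with ω hω using gammaFn_eq hω d k
  have h := hq.ae_tendsto_average (measurable_gammaFn d) (k := k)
    ((hq.integrable_gammaStar d k).congr hae.symm)
  rw [integral_congr_ae hae] at h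
  filter_upwards [h, hq.ae_tendsto_TD_div k, hq.ae_good, hq.ae_X_nonneg, hq.ae_TD_zero_nonneg]
    with ω hγ hTD hz hx h0
  have hm : Measurable fun t => (q.violation d).indicator (fun _ => (1 : ℝ)) (t, ω) :=
    (hq.measurable_indicator_violation d).comp (measurable_id.prodMk measurable_const)
  have hpos := hq.integral_cycle_pos k
  have key := tendsto_integral_div_of_subsequence hm
    (fun t => (norm_indicator_le_norm_self (fun _ => (1 : ℝ)) _).trans_eq norm_one)
    (mul_pos two_pos hpos) hTD (γ := 2 * ∫ ω, q.gammaStar d (k + 1) ω ∂P)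
    (hγ.congr fun n => by
      rw [integral_violation hz hx h0 d hm]
      exact congrArg (· / (n : ℝ)) (Finset.sum_congr rfl fun j _ => gammaFn_eq hz d j))
  -- Both rates were taken along an even number `2 * n` of cycles; the factors 2 cancel.
  rwa [mul_div_mul_left _ _ two_ne_zero, div_eq_mul_one_div, mul_comm] at key

/-- Expectation of the almost sure limit: Fubini exchanges the two integrals, and the averages are
bounded by 1. -/
theorem tendsto_average_measure_violation (hq : q.IsGIGI11 P) (d : ℝ) (k : ℕ) :
    Tendsto (fun n : ℕ => (∫ t in (0 : ℝ)..n, P.real {ω | (t, ω) ∈ q.violation d}) / n) atTop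
      (𝓝 (q.nu P (k + 1) * ∫ ω, q.gammaStar d (k + 1) ω ∂P)) := by
  have hm := hq.measurable_indicator_violation d
  have hb : ∀ p, ‖(q.violation d).indicator (fun _ => (1 : ℝ)) p‖ ≤ 1 := fun p =>
    (norm_indicator_le_norm_self (fun _ => (1 : ℝ)) _).trans_eq norm_one
  have hint : ∀ n : ℕ, ∫ t in (0 : ℝ)..n, P.real {ω | (t, ω) ∈ q.violation d}
      = ∫ ω, (∫ t in (0 : ℝ)..n, (q.violation d).indicator (fun _ => (1 : ℝ)) (t, ω)) ∂P := by
    intro n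
    rw [← intervalIntegral_integral_swap
      (f := fun t ω => (q.violation d).indicator (fun _ => (1 : ℝ)) (t, ω))]
    · refine intervalIntegral.integral_congr fun t _ => ?_
      have hs : MeasurableSet {ω | (t, ω) ∈ q.violation d} :=
        (hq.measurableSet_violation d).preimage measurable_prodMk_left
      exact (integral_indicator_one hs).symm
    · have : IsFiniteMeasure (volume.restrict (Set.uIoc (0 : ℝ) n)) := by
        rw [Set.uIoc_of_le n.cast_nonneg]; infer_instance
      exact Integrable.of_bound hm.aestronglyMeasurable 1 (ae_of_all _ hb)
  have hdom := tendsto_integral_of_dominated_convergence (μ := P) (fun _ => (1 : ℝ))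
    (F := fun (n : ℕ) ω => (∫ t in (0 : ℝ)..n,
      (q.violation d).indicator (fun _ => (1 : ℝ)) (t, ω)) / n)
    (f := fun _ => q.nu P (k + 1) * ∫ ω, q.gammaStar d (k + 1) ω ∂P) ?_ (integrable_const 1) ?_
    (hq.ae_tendsto_violation d k)
  · simp only [integral_const, probReal_univ, one_smul] at hdom
    refine hdom.congr fun n => ?_
    rw [hint, integral_div]
  · intro n
    refine (Measurable.div_const ?_ _).aestronglyMeasurable
    simp only [intervalIntegral.integral_of_le n.cast_nonneg]
    exact (StronglyMeasurable.integral_prod_left' (hm.stronglyMeasurable)).measurable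
  · refine fun n => ae_of_all _ fun ω => ?_
    rw [norm_div, Real.norm_natCast]
    refine div_le_one_of_le₀ ?_ n.cast_nonneg
    have := intervalIntegral.norm_integral_le_of_norm_le_const (C := 1) (a := 0) (b := (n : ℝ))
      fun t _ => hb (t, ω)
    simpa using this

/-- The set `violation` is jointly measurable in time and outcome, as Fubini needs. It agrees with
the event `d < aoi` from the departure of packet 0 on, so the symmetric difference has probability
tending to 0. -/
theorem tendsto_measure_violation (hq : q.IsGIGI11 P) (d : ℝ) {p : ℝ}
    (hmeas : ∀ t, 0 ≤ t → AEMeasurable (q.aoi t) P)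
    (hp : ∀ t, 0 ≤ t → P.real {ω | d < q.aoi t ω} = p) :
    Tendsto (fun t : ℝ => P.real {ω | (t, ω) ∈ q.violation d}) atTop (𝓝 p) := by
  have hm := hq.measurable_indicator_violation d
  have hsV : ∀ t : ℝ, MeasurableSet {ω | (t, ω) ∈ q.violation d} := fun t =>
    (hq.measurableSet_violation d).preimage measurable_prodMk_left
  have hsA : ∀ t : ℝ, 0 ≤ t → NullMeasurableSet {ω | d < q.aoi t ω} P := fun t ht =>
    nullMeasurableSet_lt aemeasurable_const (hmeas t ht)
  have hdom := tendsto_integral_filter_of_dominated_convergence (μ := P) (l := atTop)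
    (fun _ => (1 : ℝ)) (F := fun (t : ℝ) => (symmDiff {ω | (t, ω) ∈ q.violation d}
      {ω | d < q.aoi t ω}).indicator fun _ => (1 : ℝ)) (f := fun _ => 0) ?_ ?_
    (integrable_const 1) ?_
  · rw [integral_zero] at hdom
    rw [tendsto_iff_norm_sub_tendsto_zero]
    refine squeeze_zero' (Eventually.of_forall fun t => norm_nonneg _) ?_ hdom
    filter_upwards [eventually_ge_atTop 0] with t ht
    rw [← hp t ht, Real.norm_eq_abs, integral_indicator₀ ((hsV t).nullMeasurableSet.symmDiff
      (hsA t ht)), setIntegral_const, smul_eq_mul, mul_one]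
    exact abs_measureReal_sub_le_measureReal_symmDiff' (hsV t).nullMeasurableSet (hsA t ht)
      (by finiteness) (by finiteness)
  · filter_upwards [eventually_ge_atTop 0] with t ht
    exact aestronglyMeasurable_const.indicator₀ ((hsV t).nullMeasurableSet.symmDiff (hsA t ht))
  · exact Eventually.of_forall fun t => ae_of_all _ fun ω =>
      (norm_indicator_le_norm_self (fun _ => (1 : ℝ)) _).trans_eq norm_one
  · filter_upwards [hq.ae_good, hq.ae_X_nonneg, hq.init_order, hq.ae_exists_lt_TD]
      with ω hz hx hi hex
    refine tendsto_const_nhds.congr' ?_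
    filter_upwards [eventually_ge_atTop (q.TD 0 ω)] with t ht
    obtain ⟨j, hj1, hj2⟩ := exists_TD_le_lt ht (hex t)
    refine (Set.indicator_of_notMem ?_ _).symm
    have h1 := mem_violation_iff hz hx (d := d) hj1 hj2
    rw [← aoi_eq hz hx hi hj1 hj2] at h1
    rintro (h | h)
    · exact h.2 (h1.1 h.1)
    · exact h.2 (h1.2 h.1)

theorem measureReal_aoi_eq (hq : q.IsGIGI11 P) (hstat : IsStationaryProcess P q.aoi) (d : ℝ)
    (k : ℕ) {t : ℝ} (ht : 0 ≤ t) : P.real {ω | d < q.aoi t ω}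
      = q.nu P (k + 1) * ∫ ω, q.gammaStar d (k + 1) ω ∂P := by
  -- Only the one-dimensional marginals are needed. Measurability of the AoI is also drawn from
  -- here, being part of `IdentDistrib`.
  have hid : ∀ s, 0 ≤ s → IdentDistrib (fun ω (_ : Fin 1) => q.aoi (0 + s) ω)
      (fun ω (_ : Fin 1) => q.aoi 0 ω) P P := fun s hs =>
    hstat 1 (fun _ => 0) (fun _ => le_rfl) s hs
  have hmeas : ∀ s, 0 ≤ s → AEMeasurable (q.aoi s) P := fun s hs => by
    have := aemeasurable_pi_iff.1 (hid s hs).aemeasurable_fst 0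
    rwa [zero_add] at this
  have hconst : ∀ s, 0 ≤ s → P.real {ω | d < q.aoi s ω} = P.real {ω | d < q.aoi 0 ω} := by
    intro s hs
    have := (hid s hs).measure_mem_eq (s := {y : Fin 1 → ℝ | d < y 0})
      (measurableSet_lt measurable_const (measurable_pi_apply 0))
    rw [zero_add] at this
    exact congrArg ENNReal.toReal this
  rw [hconst t ht]
  have hu : Measurable fun s : ℝ => P.real {ω | (s, ω) ∈ q.violation d} :=
    (measurable_measure_prodMk_left (hq.measurableSet_violation d)).ennreal_toReal
  -- The time averages of the probability of `violation` have two limits: the constant violation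
  -- probability, and the long-run fraction of time above `d`.
  refine tendsto_nhds_unique (tendsto_average_of_tendsto hu (fun s => ?_)
    (hq.tendsto_measure_violation d hmeas hconst)) (hq.tendsto_average_measure_violation d k)
  rw [Real.norm_of_nonneg measureReal_nonneg]
  exact measureReal_le_one

end IsGIGI11

end GG11

theorem theorem7 {Ω : Type*} [MeasurableSpace Ω] (P : Measure Ω) [IsProbabilityMeasure P]
    (q : GG11 Ω) (hq : q.IsGIGI11 P) (hstat : IsStationaryProcess P q.aoi)
    (d : ℝ) (hd : 0 < d) (k : ℕ) (hk : 1 ≤ k) :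
    Integrable (q.X k) P ∧ Integrable (q.idle k) P ∧
    0 < ∫ ω, q.X k ω ∂P + ∫ ω, q.idle k ω ∂P ∧
    Integrable (q.gammaStar d k) P ∧ Integrable (q.Gamma1 d k) P ∧
    Tendsto (fun t : ℝ => P.real {ω | d < q.aoi t ω}) atTop
      (𝓝 (q.nu P k * ∫ ω, q.gammaStar d k ω ∂P)) ∧
    ∀ nuHat : ℝ, q.nu P k ≤ nuHat →
      q.nu P k * ∫ ω, q.gammaStar d k ω ∂P ≤ nuHat * ∫ ω, q.Gamma1 d k ω ∂P := by
  obtain ⟨k, rfl⟩ := Nat.exists_eq_add_of_le' hk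
  have hpos := hq.integral_cycle_pos k
  refine ⟨hq.integrable_X _, hq.integrable_idle k, hpos, hq.integrable_gammaStar d k,
    hq.integrable_Gamma1 d k, ?_, fun nuHat hnu => ?_⟩
  · refine tendsto_const_nhds.congr' ?_
    filter_upwards [eventually_ge_atTop 0] with t ht
    exact (hq.measureReal_aoi_eq hstat d k ht).symm
  · have hnu0 : 0 ≤ q.nu P (k + 1) := one_div_nonneg.2 hpos.le
    exact (mul_le_mul_of_nonneg_left (hq.integral_gammaStar_le d k) hnu0).trans
      (mul_le_mul_of_nonneg_right hnu (hq.integral_Gamma1_nonneg d k))
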